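/- **Setting.** Let $1\le n_w<n_s$, $L\ge 1$ be integers, $p\ge 1$, $c\ge 0$, $K>0$ real. Let $\Theta=\mathbb R^{n_s}\times\mathbb S^{n_s}$, with $\mathbb S^{n_s}$ the set of covariance matrices, and write $\theta=(\mu,\Sigma)$. For each $\theta\in\Theta$ let $\kappa(\theta)$ be a law on $\mathbb R^{n_s}$, measurable in $\theta$, with moments of all orders, mean $\mu$ and covariance $\Sigma$. The parameter $\tilde\theta=(\tilde\mu,\tilde\Sigma)$ is random and, given $\tilde\theta$, the simulations $P_j=(P_j^1,\dots,P_j^{n_s})$, $j\ge1$, are i.i.d. with law $\kappa(\tilde\theta)$. Let $\mathcal M$ be a set of probability measures on $\Theta$. *Controls.* A control is a process $\alpha=(q_\ell,N_\ell)_{0\le\ell\le L}$, a function of the simulations, with integer values, $q$ non-increasing with values in $[n_w,n_s]$, $q_0=n_s$, $q_{L-1}=n_w$, $N$ non-decreasing, $N_0=0$. Put $\hat\mu^i_\ell=\frac1{N_\ell}\sum_{j\le N_\ell}P^i_j$; $\mathfrak I_0=\{1,\dots,n_s\}$; and for $\ell\ge1$ let $\mathfrak I_\ell$ be the set of the first $q_\ell$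 elements of $\mathfrak I_{\ell-1}$ ranked by decreasing $\hat\mu_\ell$, ties being broken in favour of the smaller index. Let $\mathcal F^\alpha_0$ be trivial and $\mathcal F^\alpha_\ell=\mathcal F^\alpha_{\ell-1}\vee\sigma(P^i_j:\ i\in\mathfrak I_{\ell-1},\ j\le N_\ell)$. The set $\mathcal A^{\rm ad}$ consists of the controls such that $(q_\ell,N_\ell)$ is $\mathcal F^\alpha_{\ell-1}$-measurable for $1\le\ell\le L$, and $\mathcal A^{\rm ad}(\ell,\alpha)$ of the $\alpha'\in\mathcal A^{\rm ad}$ that coincide with $\alpha$ at levels $0,\dots,\ell$ and satisfy $\sum_{l=0}^{L-1}q'_l(N'_{l+1}-N'_l)\le K$. *Costs* (with $x/0=0$, $\max\emptyset=0$, $\delta q_\ell=q_{\ell-1}-q_\ell$, $\delta N_\ell=N_\ell-N_{\ell-1}$, $\tilde\sigma_{ik}^2=\tilde\Sigma^{ii}+\tilde\Sigma^{kk}-2\tilde\Sigma^{ik}$). For $\ell\ge1$, with $\rho_\ell[i,k]=\tilde\mu^i-\tilde\mu^k+\frac{N_{\ell-1}}{\delta N_\ell}(\hat\mu^i_{\ell-1}-\hat\mu^k_{\ell-1})$,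 let $$f^{\rm ad}_p(\ell,\alpha,\tilde\theta)=\delta q_\ell\max_{(i,k)}(\tilde\mu^i-\tilde\mu^k)^p\Big(e^{-\frac{\delta N_\ell\,\rho_\ell[i,k]^2}{2(\tilde\sigma_{ik}^2+c\rho_\ell[i,k])}}\mathbf 1_{\{\rho_\ell[i,k]\ge0\}}+\mathbf 1_{\{\rho_\ell[i,k]<0\}}\Big),$$ the maximum being over $i,k\in\mathfrak I_{\ell-1}$ whose ranks in $\mathfrak I_{\ell-1}$, by decreasing $\tilde\mu$ with the same tie-break, lie in $[1,n_w]$ and in $[q_\ell+1,q_{\ell-1}]$ respectively. *Current laws.* Let $\nu$ be an $\mathcal F^\alpha_\ell$-measurable random measure with values in $\mathcal M$ (for instance a fixed $\nu\in\mathcal M$), viewed as the law of $\tilde\theta$ given $\mathcal F^\alpha_\ell$. Then $\mathbb E^\nu[\,\cdot\,|\mathcal F^\alpha_\ell]$ is the conditional expectation when, given $\mathcal F^\alpha_\ell$, $\tilde\theta$ has law $\nu$ and, given also $\tilde\theta$, the simulations $P_j$, $j>N_\ell$, are i.i.d. with law $\kappa(\tilde\theta)$. For an arbitrary law $\lambda$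 of the simulations made before, $\mathbb P^\nu$ is the resulting joint law of $\tilde\theta$ and the simulations (for $\ell=0$: $\tilde\theta\sim\nu$). Almost sure statements and essential infima refer to $\mathbb P^\nu$. Define, in $[0,\infty]$, $${\rm F}^{\rm ad}_p(\ell,\alpha',\nu)=\mathbb E^\nu\Big[\Big|\frac1{n_w}\sum_{i\in\mathfrak I^{\alpha'}_{L-1}}(\hat\mu_L^{\alpha',i}-\tilde\mu^i)\Big|^p+\sum_{l=\ell+1}^{L-1}f^{\rm ad}_p(l,\alpha',\tilde\theta)\,\Big|\,\mathcal F^{\alpha'}_\ell\Big],\qquad \hat{\rm F}^{\rm ad}_p(\ell,\alpha,\nu)=\operatorname*{ess\,inf}_{\alpha'\in\mathcal A^{\rm ad}(\ell,\alpha)}{\rm F}^{\rm ad}_p(\ell,\alpha',\nu).$$ *Assumption (under $\mathbb P^\nu$, from step $\ell$ on).* There are a measure $m$ and a nonnegative measurable bounded map $g$, continuous in its first argument uniformly in $\theta$, such that for all $\alpha'\in\mathcal A^{\rm ad}$ coinciding with $\alpha$ up to level $\ell$ and all $\ell<l\le L$, the law of $I^{\alpha'}_l=(P^i_j:\ i\in\mathfrak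 I^{\alpha'}_{l-1},\ N'_{l-1}<j\le N'_l)$ given $\mathcal F^{\alpha'}_{l-1}\vee\sigma(\tilde\theta)$ has a.s. the density $g(\cdot,\mathfrak I^{\alpha'}_{l-1},N'_{l-1},N'_l,\tilde\theta|_{\mathfrak I^{\alpha'}_{l-1}})$ with respect to $m$, where $\theta|_A=((\mu^i)_{i\in A},(\Sigma^{ik})_{i,k\in A})$; and for all these $\alpha'$ and all $\ell\le l\le L$ the law of $\tilde\theta$ given $\mathcal F^{\alpha'}_l$ belongs a.s. to $\mathcal M$. *Bayesian update.* $$\mathcal U(\ell+1,\alpha',\nu)(d\theta)=\frac{g(I^{\alpha'}_{\ell+1},\mathfrak I^{\alpha'}_\ell,N'_\ell,N'_{\ell+1},\theta|_{\mathfrak I^{\alpha'}_\ell})\,\nu(d\theta)}{\int_\Theta g(I^{\alpha'}_{\ell+1},\mathfrak I^{\alpha'}_\ell,N'_\ell,N'_{\ell+1},\vartheta|_{\mathfrak I^{\alpha'}_\ell})\,\nu(d\vartheta)}.$$ **Proposition 4.** Let $\alpha\in\mathcal A^{\rm ad}$, $0\le\ell\le L-2$, let $\nu$ be an $\mathcal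 F^\alpha_\ell$-measurable $\mathcal M$-valued random measure (in particular any fixed $\nu\in\mathcal M$), and let the Assumption hold. Then $\mathcal U(\ell+1,\alpha',\nu)\in\mathcal M$ a.s. for every $\alpha'\in\mathcal A^{\rm ad}(\ell,\alpha)$, and almost surely $$\hat{\rm F}^{\rm ad}_p(\ell,\alpha,\nu)=\operatorname*{ess\,inf}_{\alpha'\in\mathcal A^{\rm ad}(\ell,\alpha)}\mathbb E^\nu\big[\hat{\rm F}^{\rm ad}_p(\ell+1,\alpha',\mathcal U(\ell+1,\alpha',\nu))+f^{\rm ad}_p(\ell+1,\alpha',\tilde\theta)\,\big|\,\mathcal F^\alpha_\ell\big].$$ -/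

import Mathlib

open MeasureTheory ProbabilityTheory
open scoped ENNReal NNReal

noncomputable section

namespace AdaptiveES

/-- A parameter `θ = (μ, Σ)` on an index set `ι`: a vector of means and a covariance matrix. -/
abbrev Param (ι : Type) : Type :=
  (ι → ℝ) × {S : ι → ι → ℝ // (Matrix.of S).PosSemidef}

/-- Restriction of `θ = (μ, Σ)` to the components whose indices lie in `A`. -/
def Param.restrict {n : ℕ} (A : Finset (Fin n)) (θ : Param (Fin n)) : Param A :=
  (fun i => θ.1 i, ⟨fun i k => θ.2.1 i k, θ.2.2.submatrix (fun i : A => (i : Fin n))⟩)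

/-- A realisation of all simulations: `x j i` is the `(j+1)`-th simulated price in scenario `i`. -/
abbrev Path (n : ℕ) : Type := ℕ → Fin n → ℝ

/-- The fixed data: number of scenarios, of worst scenarios, of levels, the exponent `p`, the
sub-gamma constant `c` and the total effort `K`. -/
structure Setup where
  ns : ℕ
  nw : ℕ
  L : ℕ
  p : ℝ
  c : ℝ
  K : ℝ
  one_le_nw : 1 ≤ nw
  nw_lt_ns : nw < ns
  one_le_L : 1 ≤ L
  one_le_p : 1 ≤ p
  c_nonneg : 0 ≤ c
  K_pos : 0 < K

/-- The law of the vector of scenario prices given the parameter: it has moments of all orders,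
and the parameter is its mean vector and its covariance matrix. -/
structure Market (n : ℕ) where
  law : Kernel (Param (Fin n)) (Fin n → ℝ)
  isMarkov : IsMarkovKernel law
  memLp : ∀ θ i (r : ℝ≥0), 1 ≤ r → MemLp (fun z : Fin n → ℝ => z i) r (law θ)
  mean_eq : ∀ θ i, ∫ z, z i ∂(law θ) = θ.1 i
  cov_eq : ∀ θ i k, cov[fun z : Fin n → ℝ => z i, fun z => z k; law θ] = θ.2.1 i k

theorem measurable_iid {n : ℕ} (mkt : Market n) :
    Measurable fun θ => Measure.infinitePi fun _ : ℕ => mkt.law θ := by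
  have := mkt.isMarkov
  refine Measurable.measure_of_isPiSystem_of_isProbabilityMeasure
    generateFrom_squareCylinders.symm
    (isPiSystem_squareCylinders (fun _ => MeasurableSpace.isPiSystem_measurableSet) (by simp)) ?_
  rintro _ ⟨s, t, ht, rfl⟩
  have ht' : ∀ i, MeasurableSet (t i) := fun i => ht i (Set.mem_univ i)
  have h : ∀ θ, Measure.infinitePi (fun _ : ℕ => mkt.law θ) ((s : Set ℕ).pi t)
      = ∏ i ∈ s, mkt.law θ (t i) := fun θ => Measure.infinitePi_pi _ fun i _ => ht' i
  simp_rw [h]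
  exact Finset.measurable_prod _ fun i _ => Kernel.measurable_coe _ (ht' i)

/-- Given `θ`, the simulations are independent copies of the price vector. -/
def Market.iid {n : ℕ} (mkt : Market n) : Kernel (Param (Fin n)) (Path n) :=
  ⟨fun θ => Measure.infinitePi fun _ : ℕ => mkt.law θ, measurable_iid mkt⟩

/-! ### Controls and the selection algorithm -/

/-- A process `α = (q, N)`; only the levels `0, …, L` matter. -/
structure Control (n : ℕ) where
  q : ℕ → Path n → ℕ
  N : ℕ → Path n → ℕ

/-- Monte Carlo mean of the first `N` simulations in scenario `i`. -/
def estimate {n : ℕ} (N : ℕ) (x : Path n) (i : Fin n) : ℝ :=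
  (∑ j ∈ Finset.range N, x j i) / N

/-- Number of elements of `A` that precede `i` when `A` is ranked by decreasing `v`, ties being
broken in favour of the smaller index. The element of rank `r` in `A`, that is the image of `r`
under the ranking permutation, is the one with `position = r - 1`. -/
def position {n : ℕ} (A : Finset (Fin n)) (v : Fin n → ℝ) (i : Fin n) : ℕ :=
  (A.filter fun k => v i < v k ∨ (v k = v i ∧ k < i)).card

/-- The set of scenarios kept after step `l`: all at step `0`, then at step `l + 1` the
`q (l + 1)` first ones in the ranking of the estimates. -/
def Control.selected {n : ℕ} (α : Control n) : ℕ → Path n → Finset (Fin n)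
  | 0, _ => Finset.univ
  | l + 1, x => (α.selected l x).filter fun i =>
      position (α.selected l x) (estimate (α.N (l + 1) x) x) i < α.q (l + 1) x

/-- The information after each step. Step `l + 1` reveals the first `N (l + 1)` simulations in the
scenarios still under consideration when that step is run. -/
def Control.filtration {n : ℕ} (α : Control n) : ℕ → MeasurableSpace (Path n)
  | 0 => ⊥
  | l + 1 => α.filtration l ⊔ MeasurableSpace.comap
      (fun (x : Path n) (j : ℕ) (i : Fin n) =>
        if i ∈ α.selected l x ∧ j < α.N (l + 1) x then x j i else 0) inferInstance

/-- Admissible controls: `q` is non-increasing from `ns` to `nw = q (L - 1)`, `N` is non-decreasing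
from `0`, and both are predictable for the information that the control generates. -/
structure Setup.Admissible (S : Setup) (α : Control S.ns) : Prop where
  q_zero : ∀ x, α.q 0 x = S.ns
  q_last : ∀ x, α.q (S.L - 1) x = S.nw
  q_anti : ∀ l < S.L, ∀ x, α.q (l + 1) x ≤ α.q l x
  nw_le_q : ∀ l ≤ S.L, ∀ x, S.nw ≤ α.q l x
  N_zero : ∀ x, α.N 0 x = 0
  N_mono : ∀ l < S.L, ∀ x, α.N l x ≤ α.N (l + 1) x
  q_predictable : ∀ l < S.L, Measurable[α.filtration l] (α.q (l + 1))
  N_predictable : ∀ l < S.L, Measurable[α.filtration l] (α.N (l + 1))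

/-- The two controls coincide at the levels `0, …, l`. -/
def AgreeUpTo {n : ℕ} (l : ℕ) (α α' : Control n) : Prop :=
  ∀ k ≤ l, α'.q k = α.q k ∧ α'.N k = α.N k

/-- Total computational cost. -/
def Setup.totalCost (S : Setup) (α : Control S.ns) (x : Path S.ns) : ℝ :=
  ∑ l ∈ Finset.range S.L, (α.q l x : ℝ) * ((α.N (l + 1) x : ℝ) - α.N l x)

/-- Admissible continuations of `α` after step `l` that respect the budget. -/
def Setup.continuations (S : Setup) (l : ℕ) (α : Control S.ns) : Set (Control S.ns) :=
  {α' | S.Admissible α' ∧ AgreeUpTo l α α' ∧ ∀ x, S.totalCost α' x ≤ S.K}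

/-! ### Costs -/

/-- `ρ_l[i,k]`, for `l ≥ 1`. -/
def rho {n : ℕ} (α : Control n) (l : ℕ) (θ : Param (Fin n)) (x : Path n) (i k : Fin n) : ℝ :=
  θ.1 i - θ.1 k + (α.N (l - 1) x : ℝ) / ((α.N l x : ℝ) - α.N (l - 1) x) *
    (estimate (α.N (l - 1) x) x i - estimate (α.N (l - 1) x) x k)

/-- The variance of the difference of the prices in the scenarios `i` and `k`. -/
def sigmaSq {n : ℕ} (θ : Param (Fin n)) (i k : Fin n) : ℝ :=
  θ.2.1 i i + θ.2.1 k k - 2 * θ.2.1 i k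

/-- The selection cost `f_p(l, α, θ)` of step `l ≥ 1`. The pairs `(i, k)` are those of
scenarios kept before step `l` such that, in the ranking by the true means, `i` has rank in
`[1, nw]` and `k` has rank in `[q_l + 1, q_{l-1}]`; the maximum over no pair is `0`. -/
def Setup.stepCost (S : Setup) (α : Control S.ns) (l : ℕ) (ω : Param (Fin S.ns) × Path S.ns) :
    ℝ≥0∞ :=
  let θ := ω.1
  let x := ω.2
  let A := α.selected (l - 1) x
  ((α.q (l - 1) x - α.q l x : ℕ) : ℝ≥0∞) *
    ((A ×ˢ A).filter fun ik => position A θ.1 ik.1 < S.nw ∧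
        α.q l x ≤ position A θ.1 ik.2 ∧ position A θ.1 ik.2 < α.q (l - 1) x).sup
      fun ik =>
        let r := rho α l θ x ik.1 ik.2
        ENNReal.ofReal ((θ.1 ik.1 - θ.1 ik.2) ^ S.p *
          if 0 ≤ r then
            Real.exp (-((((α.N l x : ℝ) - α.N (l - 1) x) * r ^ 2) /
              (2 * (sigmaSq θ ik.1 ik.2 + S.c * r))))
          else 1)

/-- The `p`-th power of the final Monte Carlo error. -/
def Setup.finalCost (S : Setup) (α : Control S.ns) (ω : Param (Fin S.ns) × Path S.ns) : ℝ≥0∞ :=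
  ENNReal.ofReal (|1 / (S.nw : ℝ) * ∑ i ∈ α.selected (S.L - 1) ω.2,
    (estimate (α.N S.L ω.2) ω.2 i - ω.1.1 i)| ^ S.p)

/-- The cost that remains after step `l`. -/
def Setup.costToGo (S : Setup) (l : ℕ) (α : Control S.ns) (ω : Param (Fin S.ns) × Path S.ns) :
    ℝ≥0∞ :=
  S.finalCost α ω + ∑ k ∈ Finset.Icc (l + 1) (S.L - 1), S.stepCost α k ω

/-! ### Conditional expectations for a given current law of the parameter -/

/-- The path whose first `N` simulations are those of `x` and whose later ones are those of `y`. -/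
def splice {n : ℕ} (N : ℕ) (x y : Path n) : Path n := fun j => if j < N then x j else y j

/-- `𝔼^ν[Φ | F_l]`: the simulations used up to step `l` are frozen, the parameter has the current
(possibly random) law `ν`, and given the parameter the later simulations are fresh independent
copies of the price vector. -/
def condE {n : ℕ} (mkt : Market n) (l : ℕ) (α : Control n) (ν : Path n → Measure (Param (Fin n)))
    (Φ : Param (Fin n) × Path n → ℝ≥0∞) (x : Path n) : ℝ≥0∞ :=
  ∫⁻ θ, ∫⁻ y, Φ (θ, splice (α.N l x) x y) ∂(mkt.iid θ) ∂(ν x)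

/-- `ℙ^ν`, the joint law of the parameter and of the simulations for which `condE` is the
conditional expectation given `F_l`: the past up to step `l` is drawn from `past`, and the
law of the parameter given `F_l` is `ν`. For `l = 0` the choice of `past` is immaterial. -/
def stepLaw {n : ℕ} (mkt : Market n) (l : ℕ) (α : Control n)
    (ν : Kernel (Path n) (Param (Fin n))) (past : Measure (Path n)) :
    Measure (Param (Fin n) × Path n) :=
  ((past ⊗ₘ ν) ⊗ₘ (mkt.iid.comap Prod.snd measurable_snd)).map
    fun w => (w.1.2, splice (α.N l w.1.1) w.1.1 w.2)

/-! ### Essential infimum of a family of random variables -/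

/-- `V` is the essential infimum of the family `T`: the greatest (up to null sets) random
variable that lies almost surely below each member. -/
structure IsEssInfFamily {X : Type*} [MeasurableSpace X] (P : Measure X) (T : Set (X → ℝ≥0∞))
    (V : X → ℝ≥0∞) : Prop where
  measurable : Measurable V
  le : ∀ f ∈ T, V ≤ᵐ[P] f
  greatest : ∀ h : X → ℝ≥0∞, Measurable h → (∀ f ∈ T, h ≤ᵐ[P] f) → h ≤ᵐ[P] V

theorem exists_isEssInfFamily {X : Type*} [MeasurableSpace X] (P : Measure X) [IsFiniteMeasure P]
    (T : Set (X → ℝ≥0∞)) : ∃ V, IsEssInfFamily P T V := by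
  let H : Set (X → ℝ≥0∞) := {h | Measurable h ∧ ∀ f ∈ T, h ≤ᵐ[P] f}
  let I : (X → ℝ≥0∞) → ℝ≥0∞ := fun h => ∫⁻ x, (1 + h x)⁻¹ ∂P
  have h0 : (fun _ => 0 : X → ℝ≥0∞) ∈ H :=
    ⟨measurable_const, fun f _ => Filter.Eventually.of_forall fun x => zero_le⟩
  have hne : (I '' H).Nonempty := ⟨_, _, h0, rfl⟩
  obtain ⟨u, -, hu, huI⟩ := exists_seq_tendsto_sInf hne (OrderBot.bddBelow _)
  choose h hH hI using huI
  let V : X → ℝ≥0∞ := fun x => ⨆ k, h k x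
  have hVH : V ∈ H := by
    refine ⟨Measurable.iSup fun k => (hH k).1, fun f hf => ?_⟩
    have : ∀ᵐ x ∂P, ∀ k, h k x ≤ f x := ae_all_iff.2 fun k => (hH k).2 f hf
    filter_upwards [this] with x hx using iSup_le hx
  have hVI : I V ≤ sInf (I '' H) := by
    refine ge_of_tendsto' hu fun k => ?_
    rw [← hI k]
    refine lintegral_mono fun x => ENNReal.inv_le_inv.2 ?_
    gcongr
    exact le_iSup (fun k => h k x) k
  refine ⟨V, hVH.1, hVH.2, fun g hg hgT => ?_⟩
  let W : X → ℝ≥0∞ := fun x => g x ⊔ V x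
  have hWH : W ∈ H := by
    refine ⟨hg.sup hVH.1, fun f hf => ?_⟩
    filter_upwards [hgT f hf, hVH.2 f hf] with x h1 h2 using sup_le h1 h2
  have hle : I V ≤ I W := hVI.trans (sInf_le ⟨W, hWH, rfl⟩)
  have hfin : I W ≠ ∞ := by
    refine ne_top_of_le_ne_top (measure_ne_top P Set.univ) ?_
    calc I W ≤ ∫⁻ _, 1 ∂P := lintegral_mono fun x => by simp
      _ = P Set.univ := by simp
  have hae : (fun x => (1 + W x)⁻¹) =ᵐ[P] fun x => (1 + V x)⁻¹ := by
    refine ae_eq_of_ae_le_of_lintegral_le ?_ hfin ?_ hle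
    · refine Filter.Eventually.of_forall fun x => ENNReal.inv_le_inv.2 ?_
      gcongr
      exact le_sup_right
    · exact ((measurable_const.add hVH.1).inv).aemeasurable
  filter_upwards [hae] with x hx
  have h1 : 1 + W x = 1 + V x := inv_injective hx
  have h2 : W x = V x := (ENNReal.add_right_inj ENNReal.one_ne_top).1 h1
  exact le_sup_left.trans h2.le

open Classical in
/-- A version of the essential infimum of the family `T`; it exists whenever `P` is finite. -/
def essInfFamily {X : Type*} [MeasurableSpace X] (P : Measure X) (T : Set (X → ℝ≥0∞)) :
    X → ℝ≥0∞ :=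
  if h : ∃ V, IsEssInfFamily P T V then h.choose else 0

/-- The value function: the essential infimum, over the continuations `α'` of `α` after step `l`,
of the conditional expected cost to go when the current law of the parameter is `ν`. Null sets are
those of the law `P` of the simulations. -/
def Setup.value (S : Setup) (mkt : Market S.ns) (P : Measure (Path S.ns)) (l : ℕ)
    (α : Control S.ns) (ν : Path S.ns → Measure (Param (Fin S.ns))) : Path S.ns → ℝ≥0∞ :=
  essInfFamily P {F | ∃ α' ∈ S.continuations l α, F = condE mkt l α' ν (S.costToGo l α')}

/-! ### Conditional densities and the Bayesian update -/

/-- The simulations number `N + 1, …, N'` in the scenarios of `A`. -/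
def block {n : ℕ} (A : Finset (Fin n)) (N N' : ℕ) (x : Path n) : A × Finset.Ico N N' → ℝ :=
  fun ij => x ij.2 ij.1

/-- A measure on each of the spaces in which a block of simulations can take its values (that is, a
measure on their disjoint union). -/
abbrev BaseMeasure (n : ℕ) : Type :=
  (A : Finset (Fin n)) → (N N' : ℕ) → Measure (A × Finset.Ico N N' → ℝ)

/-- A candidate conditional density `g(z, A, N, N', θ)` of a block of simulations. -/
abbrev DensityMap (n : ℕ) : Type :=
  (A : Finset (Fin n)) → (N N' : ℕ) → (A × Finset.Ico N N' → ℝ) → Param A → ℝ≥0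

/-- `g` is bounded, measurable, and continuous in its first argument uniformly in the parameter. -/
structure DensityMap.Regular {n : ℕ} (g : DensityMap n) : Prop where
  bounded : ∀ A N N', ∃ C, ∀ z θ, g A N N' z θ ≤ C
  measurable : ∀ A N N', Measurable (Function.uncurry (g A N N'))
  continuous : ∀ A N N', Equicontinuous fun θ z => g A N N' z θ

/-- The Bayesian update at step `l ≥ 1` of the law `ν` that the parameter has after step `l - 1`:
`ν` is reweighted by the density of the block of simulations made at step `l`. -/
def update {n : ℕ} (g : DensityMap n) (l : ℕ) (α : Control n)
    (ν : Path n → Measure (Param (Fin n))) (x : Path n) : Measure (Param (Fin n)) :=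
  let A := α.selected (l - 1) x
  let N := α.N (l - 1) x
  let N' := α.N l x
  let w : Param (Fin n) → ℝ≥0∞ := fun θ => g A N N' (block A N N' x) (θ.restrict A)
  (∫⁻ θ, w θ ∂(ν x))⁻¹ • (ν x).withDensity w

/-- `η` is a version of the conditional law of the parameter given the information `F_k` that the
control `α` generates up to step `k`, under the joint law `Q`. -/
structure IsPosterior {n : ℕ} (Q : Measure (Param (Fin n) × Path n)) (α : Control n) (k : ℕ)
    (η : Path n → Measure (Param (Fin n))) : Prop where
  measurable : Measurable[α.filtration k] η
  eq : ∀ B : Set (Param (Fin n)), MeasurableSet B →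
    ∀ G : Set (Path n), MeasurableSet[α.filtration k] G →
      Q (B ×ˢ G) = ∫⁻ x in G, η x B ∂Q.snd

/-- The standing assumption, for the joint law `Q` and from step `l` on. For every admissible `α'`
that coincides with `α` up to step `l`: almost surely, the law of the block of simulations of each
later step, given the parameter and the information available before that step (the law of that
block when the simulations are independent copies of the price vector), has the density `g` with
respect to `m`; and the law of the parameter given the information available
after each step belongs almost surely to `M`. -/
structure Setup.LearningAssumption (S : Setup) (mkt : Market S.ns)
    (M : Set (Measure (Param (Fin S.ns)))) (m : BaseMeasure S.ns) (g : DensityMap S.ns)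
    (Q : Measure (Param (Fin S.ns) × Path S.ns)) (l : ℕ) (α : Control S.ns) : Prop where
  regular : g.Regular
  density : ∀ α', S.Admissible α' → AgreeUpTo l α α' → ∀ k, l < k → k ≤ S.L →
    ∀ᵐ ω ∂Q,
      let A := α'.selected (k - 1) ω.2
      let N := α'.N (k - 1) ω.2
      let N' := α'.N k ω.2
      (mkt.iid ω.1).map (block A N N') =
        (m A N N').withDensity fun z => (g A N N' z (ω.1.restrict A) : ℝ≥0∞)
  posterior_mem : ∀ α', S.Admissible α' → AgreeUpTo l α α' → ∀ k, l ≤ k → k ≤ S.L →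
    ∀ η, IsPosterior Q α' k η → ∀ᵐ x ∂Q.snd, η x ∈ M

end AdaptiveES

end

noncomputable section

namespace AdaptiveES

/-! ### Measurability of the selection algorithm -/

/-! For a fixed continuation `α'` the cost to go splits: the hypothesis `l + 2 ≤ L` puts the
selection cost of step `l + 1` in the sum, and the rest is conditioned in two stages. By the tower
property `condE_tower`, the expectation after step `l` under `ν` is the expectation after step `l`
of the one after step `l + 1` under the Bayesian update. Its analytic core is Bayes' formula
`lintegral_bayes`: Fubini with respect to the dominating measure, followed by cancellation of the
normalising constant.

One inequality of the proposition is then immediate, since `α'` is one of its own continuations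
after step `l + 1`, so that its cost dominates the value there. For the other,
`exists_continuation_le` provides a single continuation `β` of `α'` that is within `ε` of that value
almost surely. The essential infimum is the infimum of a sequence of costs, all determined by the
information of step `l + 1`; following the first control of the sequence that is good enough is
therefore admissible. Since `β` also continues `α` after step `l`, averaging over step `l + 1` and
letting `ε` tend to `0` concludes.

Two devices support this. Admissibility is checked pathwise: a Borel map is measurable for the
information of a control as soon as it is constant on paths with the same observations
(`measurable_filtration`). And `condE`, defined pointwise by integrals, is a conditional expectation
under the law of the simulations (`lintegral_condE`), so it respects inequalities that hold only
almost surely.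

That the update lies in `M` follows from the same tower property, applied to indicators: the update
is the posterior law, to which the Assumption applies. -/

theorem measurable_glue {X Y C : Type*} [MeasurableSpace X] [MeasurableSpace Y] [Countable C]
    {c : X → C} (hc : ∀ a, MeasurableSet {x | c x = a}) {F : C → X → Y}
    (hF : ∀ a, Measurable (F a)) : Measurable fun x => F (c x) x := by
  intro s hs
  have : (fun x => F (c x) x) ⁻¹' s = ⋃ a, {x | c x = a} ∩ F a ⁻¹' s := by
    ext x; simp
  rw [this]
  exact MeasurableSet.iUnion fun a => (hc a).inter (hF a hs)

theorem measurableSet_finset_eq {X : Type*} [MeasurableSpace X] {n : ℕ} {A : X → Finset (Fin n)}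
    (hA : ∀ i, MeasurableSet {x | i ∈ A x}) (B : Finset (Fin n)) : MeasurableSet {x | A x = B} := by
  have : {x | A x = B} = ⋂ i, {x | i ∈ A x ↔ i ∈ B} := by
    ext x; simp [Finset.ext_iff]
  rw [this]
  refine MeasurableSet.iInter fun i => ?_
  by_cases h : i ∈ B
  · simpa [h] using hA i
  · simp only [h, iff_false]
    exact (hA i).compl

theorem measurable_position {X : Type*} [MeasurableSpace X] {n : ℕ} {A : X → Finset (Fin n)}
    {v : X → Fin n → ℝ} (hA : ∀ i, MeasurableSet {x | i ∈ A x})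
    (hv : ∀ i, Measurable fun x => v x i) (i : Fin n) :
    Measurable fun x => position (A x) (v x) i := by
  have : (fun x => position (A x) (v x) i) = fun x => ∑ k : Fin n,
      if k ∈ A x ∧ (v x i < v x k ∨ (v x k = v x i ∧ k < i)) then 1 else 0 := by
    ext x
    rw [position, ← Finset.card_filter]
    congr 1
    ext k
    simp
  rw [this]
  refine Finset.measurable_sum _ fun k _ => Measurable.ite ?_ measurable_const measurable_const
  refine (hA k).inter ((measurableSet_lt (hv i) (hv k)).union ?_)
  exact (measurableSet_eq_fun (hv k) (hv i)).inter (MeasurableSet.const _)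

theorem measurable_estimate {X : Type*} [MeasurableSpace X] {n : ℕ} {N : X → ℕ} {y : X → Path n}
    (hN : Measurable N) (hy : Measurable y) (i : Fin n) :
    Measurable fun x => estimate (N x) (y x) i := by
  refine measurable_glue (c := N) (F := fun a x => estimate a (y x) i)
    (fun a => hN (measurableSet_singleton a)) fun a => ?_
  refine Measurable.div_const (Finset.measurable_sum _ fun j _ => ?_) _
  exact (measurable_pi_apply i).comp ((measurable_pi_apply j).comp hy)

theorem position_congr {n : ℕ} {A : Finset (Fin n)} {v w : Fin n → ℝ} (h : ∀ i ∈ A, v i = w i)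
    {i : Fin n} (hi : i ∈ A) : position A v i = position A w i := by
  unfold position
  congr 1
  refine Finset.filter_congr fun k hk => ?_
  rw [h i hi, h k hk]

theorem estimate_congr {n N : ℕ} {x y : Path n} {i : Fin n} (h : ∀ j < N, x j i = y j i) :
    estimate N x i = estimate N y i := by
  unfold estimate
  congr 1
  exact Finset.sum_congr rfl fun j hj => h j (Finset.mem_range.1 hj)

section Information

variable {n : ℕ}

/-- The control is predictable up to level `k`. -/
def Control.PredictableUpTo (α : Control n) (k : ℕ) : Prop :=
  ∀ l < k, Measurable[α.filtration l] (α.q (l + 1)) ∧ Measurable[α.filtration l] (α.N (l + 1))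

theorem Control.PredictableUpTo.mono {α : Control n} {k k' : ℕ} (h : α.PredictableUpTo k')
    (hk : k ≤ k') : α.PredictableUpTo k := fun l hl => h l (hl.trans_le hk)

theorem Setup.Admissible.predictable {S : Setup} {α : Control S.ns} (h : S.Admissible α) :
    α.PredictableUpTo S.L := fun l hl => ⟨h.q_predictable l hl, h.N_predictable l hl⟩

theorem Control.selected_succ_subset (α : Control n) (k : ℕ) (x : Path n) :
    α.selected (k + 1) x ⊆ α.selected k x := Finset.filter_subset _ _

/-- The two claims need each other: the information of step `k + 1` is masked by the set selected at
step `k`, while the selection at step `k + 1` uses `q` and `N`, which are Borel only because the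
earlier information is. -/
theorem Control.PredictableUpTo.borel {α : Control n} {k : ℕ} (h : α.PredictableUpTo k) :
    α.filtration k ≤ MeasurableSpace.pi ∧ ∀ i, MeasurableSet {x | i ∈ α.selected k x} := by
  induction k with
  | zero => exact ⟨bot_le, fun i => by simp [Control.selected]⟩
  | succ k ih =>
    obtain ⟨h1, h2⟩ := ih (h.mono k.le_succ)
    have hq : Measurable (α.q (k + 1)) := (h k k.lt_succ_self).1.mono h1 le_rfl
    have hN : Measurable (α.N (k + 1)) := (h k k.lt_succ_self).2.mono h1 le_rfl
    refine ⟨sup_le h1 (Measurable.comap_le ?_), fun i => ?_⟩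
    · refine measurable_pi_iff.2 fun j => measurable_pi_iff.2 fun i => ?_
      refine Measurable.ite ((h2 i).inter (measurableSet_lt measurable_const hN)) ?_
        measurable_const
      exact (measurable_pi_apply i).comp (measurable_pi_apply j)
    · simp only [Control.selected, Finset.mem_filter]
      exact (h2 i).inter (measurableSet_lt
        (measurable_position h2 (measurable_estimate hN measurable_id) i) hq)

/-! ### The information generated by a control -/

/-- The paths `x` and `y` agree on all that the control observes along `x` up to step `k`. -/
def Control.SameInfo (α : Control n) (k : ℕ) (x y : Path n) : Prop :=
  ∀ l < k, ∀ i ∈ α.selected l x, ∀ j < α.N (l + 1) x, x j i = y j i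

theorem Control.SameInfo.mono {α : Control n} {k k' : ℕ} {x y : Path n} (h : α.SameInfo k' x y)
    (hk : k ≤ k') : α.SameInfo k x y := fun l hl => h l (hl.trans_le hk)

/-- The sets that do not separate `x` and `y`. -/
abbrev nonSeparating {X : Type*} (x y : X) : MeasurableSpace X where
  MeasurableSet' G := x ∈ G ↔ y ∈ G
  measurableSet_empty := by simp
  measurableSet_compl G h := by simpa using not_congr h
  measurableSet_iUnion f h := by simpa using exists_congr h

theorem eq_of_measurable_nonSeparating {X Y : Type*} [MeasurableSpace Y]
    [MeasurableSingletonClass Y] {x y : X} {m : MeasurableSpace X} (hm : m ≤ nonSeparating x y)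
    {f : X → Y} (hf : Measurable[m] f) : f x = f y :=
  (((hm _ (hf (measurableSet_singleton (f x)))) : x ∈ _ ↔ y ∈ _).1 rfl).symm

/-- The sets that do not separate `x` and `y` form a σ-algebra, so the generators suffice. Although
`SameInfo` reads the masks along `x` only, predictability makes those along `y` identical. -/
theorem Control.PredictableUpTo.sameInfo {α : Control n} {k : ℕ} (h : α.PredictableUpTo k)
    {x y : Path n} (hxy : α.SameInfo k x y) :
    α.filtration k ≤ nonSeparating x y ∧ α.selected k x = α.selected k y := by
  induction k with
  | zero => exact ⟨bot_le, rfl⟩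
  | succ k ih =>
    obtain ⟨h1, h2⟩ := ih (h.mono k.le_succ) (hxy.mono k.le_succ)
    have hq := eq_of_measurable_nonSeparating h1 (h k k.lt_succ_self).1
    have hN := eq_of_measurable_nonSeparating h1 (h k k.lt_succ_self).2
    constructor
    · refine sup_le h1 ?_
      rintro _ ⟨G, -, rfl⟩
      have : (fun (j : ℕ) (i : Fin n) =>
          if i ∈ α.selected k x ∧ j < α.N (k + 1) x then x j i else 0) = fun j i =>
          if i ∈ α.selected k y ∧ j < α.N (k + 1) y then y j i else 0 := by
        ext j i
        rw [← h2, ← hN]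
        split_ifs with hc
        · exact hxy k k.lt_succ_self i hc.1 j hc.2
        · rfl
      show _ ↔ _
      rw [Set.mem_preimage, Set.mem_preimage, this]
    · simp only [Control.selected]
      rw [← h2, ← hN, ← hq]
      refine Finset.filter_congr fun i hi => ?_
      rw [position_congr (fun i hi => estimate_congr (hxy k k.lt_succ_self i hi)) hi]

theorem Control.PredictableUpTo.eq_of_sameInfo {Y : Type*} [MeasurableSpace Y]
    [MeasurableSingletonClass Y] {α : Control n} {k : ℕ} (h : α.PredictableUpTo k)
    {x y : Path n} (hxy : α.SameInfo k x y) {f : Path n → Y} (hf : Measurable[α.filtration k] f) :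
    f x = f y := eq_of_measurable_nonSeparating (h.sameInfo hxy).1 hf

/-- What is observed along `x` up to step `k`, completed by `0`. -/
def Control.observed (α : Control n) : ℕ → Path n → Path n
  | 0, _ => 0
  | k + 1, x => fun j i =>
      if i ∈ α.selected k x ∧ j < α.N (k + 1) x then x j i else α.observed k x j i

theorem Control.sameInfo_observed (α : Control n) (k : ℕ) (x : Path n) :
    α.SameInfo k x (α.observed k x) := by
  induction k with
  | zero => intro l hl; simp at hl
  | succ k ih =>
    intro l hl i hi j hj
    simp only [Control.observed]
    split_ifs with hc
    · rfl
    · rcases Nat.lt_succ_iff_lt_or_eq.1 hl with hl | rfl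
      · exact ih l hl i hi j hj
      · exact absurd ⟨hi, hj⟩ hc

theorem Control.PredictableUpTo.measurable_observed {α : Control n} {k : ℕ}
    (h : α.PredictableUpTo k) : Measurable[α.filtration k] (α.observed k) := by
  induction k with
  | zero => exact @measurable_const _ _ _ (α.filtration 0) 0
  | succ k ih =>
    have hk := h.mono k.le_succ
    obtain ⟨hb, hsel⟩ := hk.borel
    have hN := (h k k.lt_succ_self).2
    -- The mask is read off the second argument. At `observed k x` it is the same as at `x`, so
    -- `observed (k + 1)` becomes a Borel function of the newly revealed array and of `observed k`.
    let F : Path n × Path n → Path n := fun p j i =>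
      if i ∈ α.selected k p.2 ∧ j < α.N (k + 1) p.2 then p.1 j i else p.2 j i
    have hF : Measurable F := by
      refine measurable_pi_iff.2 fun j => measurable_pi_iff.2 fun i => ?_
      refine Measurable.ite ?_ ?_ ?_
      · exact (measurable_snd (hsel i)).inter
          (measurableSet_lt measurable_const ((hN.mono hb le_rfl).comp measurable_snd))
      · exact (measurable_pi_apply i).comp ((measurable_pi_apply j).comp measurable_fst)
      · exact (measurable_pi_apply i).comp ((measurable_pi_apply j).comp measurable_snd)
    have hobs : α.observed (k + 1) = fun x => F (fun j i =>
        if i ∈ α.selected k x ∧ j < α.N (k + 1) x then x j i else 0, α.observed k x) := by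
      ext x j i
      have hs := α.sameInfo_observed k x
      simp only [Control.observed, F, ← (hk.sameInfo hs).2, ← hk.eq_of_sameInfo hs hN]
      split_ifs <;> rfl
    rw [hobs]
    refine hF.comp (Measurable.prodMk ?_ ?_)
    · exact (comap_measurable _).mono le_sup_right le_rfl
    · exact (ih hk).mono le_sup_left le_rfl

/-- A Borel map that is constant on the sets of paths with the same information up to step `k` is
measurable for that information. -/
theorem Control.PredictableUpTo.measurable_filtration {Y : Type*} [MeasurableSpace Y]
    {α : Control n} {k : ℕ} (h : α.PredictableUpTo k) {f : Path n → Y} (hf : Measurable f)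
    (hs : ∀ x y, α.SameInfo k x y → f x = f y) : Measurable[α.filtration k] f := by
  have : f = fun x => f (α.observed k x) := funext fun x => hs _ _ (α.sameInfo_observed k x)
  rw [this]
  exact hf.comp h.measurable_observed

/-! ### Controls that coincide up to some level -/

theorem AgreeUpTo.mono {α α' : Control n} {k l : ℕ} (h : AgreeUpTo l α α') (hk : k ≤ l) :
    AgreeUpTo k α α' := fun j hj => h j (hj.trans hk)

theorem AgreeUpTo.refl (l : ℕ) (α : Control n) : AgreeUpTo l α α := fun _ _ => ⟨rfl, rfl⟩

theorem AgreeUpTo.trans {α α' α'' : Control n} {l : ℕ} (h : AgreeUpTo l α α')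
    (h' : AgreeUpTo l α' α'') : AgreeUpTo l α α'' :=
  fun k hk => ⟨(h' k hk).1.trans (h k hk).1, (h' k hk).2.trans (h k hk).2⟩

theorem AgreeUpTo.selected_eq {α α' : Control n} {l : ℕ} (h : AgreeUpTo l α α') :
    α'.selected l = α.selected l := by
  induction l with
  | zero => rfl
  | succ l ih =>
    funext x
    simp only [Control.selected, ih (h.mono l.le_succ), (h (l + 1) le_rfl).1,
      (h (l + 1) le_rfl).2]

theorem AgreeUpTo.filtration_eq {α α' : Control n} {l : ℕ} (h : AgreeUpTo l α α') :
    α'.filtration l = α.filtration l := by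
  induction l with
  | zero => rfl
  | succ l ih =>
    simp only [Control.filtration, ih (h.mono l.le_succ), (h.mono l.le_succ).selected_eq,
      (h (l + 1) le_rfl).2]

theorem AgreeUpTo.sameInfo_iff {α α' : Control n} {l : ℕ} (h : AgreeUpTo l α α') (x y : Path n) :
    α'.SameInfo l x y ↔ α.SameInfo l x y := by
  refine forall₂_congr fun k hk => ?_
  rw [(h.mono hk.le).selected_eq, (h (k + 1) hk).2]

/-! ### Pasting controls -/

/-- The control that follows `β m` on the event `τ = m`. -/
def paste (β : ℕ → Control n) (τ : Path n → ℕ) : Control n where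
  q k x := (β (τ x)).q k x
  N k x := (β (τ x)).N k x

theorem selected_paste (β : ℕ → Control n) (τ : Path n → ℕ) (k : ℕ) (x : Path n) :
    (paste β τ).selected k x = (β (τ x)).selected k x := by
  induction k with
  | zero => rfl
  | succ k ih => simp only [Control.selected, ih]; rfl

theorem agreeUpTo_paste {α : Control n} {β : ℕ → Control n} {l : ℕ}
    (hβ : ∀ m, AgreeUpTo l α (β m)) (τ : Path n → ℕ) : AgreeUpTo l α (paste β τ) := by
  refine fun k hk => ⟨funext fun x => ?_, funext fun x => ?_⟩
  · exact congrFun (hβ (τ x) k hk).1 x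
  · exact congrFun (hβ (τ x) k hk).2 x

/-- Up to level `l` the pasted control is `α`. From then on the information already determines `τ`,
so two paths that the pasted control cannot distinguish have the same `τ`, and the control followed
there cannot distinguish them either. -/
theorem predictable_paste {α : Control n} {β : ℕ → Control n} {τ : Path n → ℕ} {l L : ℕ}
    (hβ : ∀ m, AgreeUpTo l α (β m)) (hp : ∀ m, (β m).PredictableUpTo L)
    (hα : α.PredictableUpTo L) (hτ : Measurable τ)
    (hτs : ∀ x y, α.SameInfo l x y → τ x = τ y) : (paste β τ).PredictableUpTo L := by
  -- Induction on the level, because the pathwise criterion for measurability at level `j`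
  -- presupposes that the pasted control is predictable up to `j`.
  suffices H : ∀ k ≤ L, (paste β τ).PredictableUpTo k from H L le_rfl
  intro k
  induction k with
  | zero => intro _ j hj; simp at hj
  | succ k ih =>
    intro hkL j hj
    rcases Nat.lt_succ_iff_lt_or_eq.1 hj with hj | rfl
    · exact ih (k.le_succ.trans hkL) j hj
    have hagree := agreeUpTo_paste hβ τ
    rcases Nat.lt_or_ge j l with hjl | hjl
    · rw [(hagree (j + 1) hjl).1, (hagree (j + 1) hjl).2, (hagree.mono hjl.le).filtration_eq]
      exact hα j hkL
    · have hP := ih (j.le_succ.trans hkL)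
      have hb : ∀ m, (β m).filtration j ≤ MeasurableSpace.pi := fun m =>
        ((hp m).mono (j.le_succ.trans hkL)).borel.1
      have key : ∀ x y, (paste β τ).SameInfo j x y →
          τ x = τ y ∧ (β (τ x)).SameInfo j x y := by
        intro x y hxy
        refine ⟨hτs x y ((hagree.sameInfo_iff x y).1 (hxy.mono hjl)), fun k hk i hi => ?_⟩
        exact hxy k hk i (by rwa [selected_paste])
      constructor
      · refine hP.measurable_filtration ?_ fun x y hxy => ?_
        · exact measurable_glue (fun a => hτ (measurableSet_singleton a))
            fun m => (hp m j hkL).1.mono (hb m) le_rfl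
        · obtain ⟨h1, h2⟩ := key x y hxy
          show (β (τ x)).q (j + 1) x = (β (τ y)).q (j + 1) y
          rw [← h1]
          exact ((hp _).mono (j.le_succ.trans hkL)).eq_of_sameInfo h2 (hp _ j hkL).1
      · refine hP.measurable_filtration ?_ fun x y hxy => ?_
        · exact measurable_glue (fun a => hτ (measurableSet_singleton a))
            fun m => (hp m j hkL).2.mono (hb m) le_rfl
        · obtain ⟨h1, h2⟩ := key x y hxy
          show (β (τ x)).N (j + 1) x = (β (τ y)).N (j + 1) y
          rw [← h1]
          exact ((hp _).mono (j.le_succ.trans hkL)).eq_of_sameInfo h2 (hp _ j hkL).2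

theorem paste_mem_continuations {S : Setup} {α : Control S.ns} {β : ℕ → Control S.ns}
    {τ : Path S.ns → ℕ} {l : ℕ} (hα : S.Admissible α) (hβ : ∀ m, β m ∈ S.continuations l α)
    (hτ : Measurable τ) (hτs : ∀ x y, α.SameInfo l x y → τ x = τ y) :
    paste β τ ∈ S.continuations l α := by
  have hP := predictable_paste (fun m => (hβ m).2.1) (fun m => (hβ m).1.predictable)
    hα.predictable hτ hτs
  exact ⟨{ q_zero := fun x => (hβ (τ x)).1.q_zero x
           q_last := fun x => (hβ (τ x)).1.q_last x
           q_anti := fun l hl x => (hβ (τ x)).1.q_anti l hl x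
           nw_le_q := fun l hl x => (hβ (τ x)).1.nw_le_q l hl x
           N_zero := fun x => (hβ (τ x)).1.N_zero x
           N_mono := fun l hl x => (hβ (τ x)).1.N_mono l hl x
           q_predictable := fun l hl => (hP l hl).1
           N_predictable := fun l hl => (hP l hl).2 },
    agreeUpTo_paste (fun m => (hβ m).2.1) τ, fun x => (hβ (τ x)).2.2 x⟩

end Information

/-! ### Measurability and information content of the costs -/

theorem measurable_finset_sup {ι X : Type*} [Fintype ι] [MeasurableSpace X] {s : X → Finset ι}
    {f : X → ι → ℝ≥0∞} (hs : ∀ i, MeasurableSet {x | i ∈ s x})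
    (hf : ∀ i, Measurable fun x => f x i) : Measurable fun x => (s x).sup (f x) := by
  classical
  have : (fun x => (s x).sup (f x)) = fun x => ⨆ i, if i ∈ s x then f x i else 0 := by
    ext x
    rw [Finset.sup_eq_iSup]
    refine iSup_congr fun i => ?_
    by_cases h : i ∈ s x <;> simp [h]
  rw [this]
  exact Measurable.iSup fun i => Measurable.ite (hs i) (hf i) measurable_const

section Costs

variable {S : Setup} {α : Control S.ns}

theorem Setup.Admissible.measurable_q (h : S.Admissible α) {k : ℕ} (hk : k ≤ S.L) :
    Measurable (α.q k) := by
  cases k with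
  | zero => rw [funext h.q_zero]; exact measurable_const
  | succ k =>
    exact (h.q_predictable k hk).mono (h.predictable.mono (Nat.le_of_succ_le hk)).borel.1 le_rfl

theorem Setup.Admissible.measurable_N (h : S.Admissible α) {k : ℕ} (hk : k ≤ S.L) :
    Measurable (α.N k) := by
  cases k with
  | zero => rw [funext h.N_zero]; exact measurable_const
  | succ k =>
    exact (h.N_predictable k hk).mono (h.predictable.mono (Nat.le_of_succ_le hk)).borel.1 le_rfl

theorem Setup.Admissible.measurableSet_mem_selected (h : S.Admissible α) {k : ℕ} (hk : k ≤ S.L)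
    (i : Fin S.ns) : MeasurableSet {x | i ∈ α.selected k x} :=
  (h.predictable.mono hk).borel.2 i

theorem Setup.Admissible.filtration_le (h : S.Admissible α) {k : ℕ} (hk : k ≤ S.L) :
    α.filtration k ≤ MeasurableSpace.pi := (h.predictable.mono hk).borel.1

theorem Setup.Admissible.measurable_rho (h : S.Admissible α) {k : ℕ} (hk : k ≤ S.L)
    (i j : Fin S.ns) :
    Measurable fun ω : Param (Fin S.ns) × Path S.ns => rho α k ω.1 ω.2 i j := by
  have h1 : Measurable fun ω : Param (Fin S.ns) × Path S.ns => (α.N k ω.2 : ℝ) :=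
    measurable_from_top.comp ((h.measurable_N hk).comp measurable_snd)
  have hN : Measurable fun ω : Param (Fin S.ns) × Path S.ns => α.N (k - 1) ω.2 :=
    (h.measurable_N ((Nat.sub_le k 1).trans hk)).comp measurable_snd
  have h2 : Measurable fun ω : Param (Fin S.ns) × Path S.ns => (α.N (k - 1) ω.2 : ℝ) :=
    measurable_from_top.comp hN
  have h3 : ∀ i, Measurable fun ω : Param (Fin S.ns) × Path S.ns =>
      estimate (α.N (k - 1) ω.2) ω.2 i := measurable_estimate hN measurable_snd
  have h4 : ∀ i, Measurable fun ω : Param (Fin S.ns) × Path S.ns => ω.1.1 i := fun i =>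
    (measurable_pi_apply i).comp (measurable_fst.comp measurable_fst)
  unfold rho
  exact ((h4 i).sub (h4 j)).add ((h2.div (h1.sub h2)).mul ((h3 i).sub (h3 j)))

theorem measurable_sigmaSq {n : ℕ} (i k : Fin n) :
    Measurable fun θ : Param (Fin n) => sigmaSq θ i k := by
  have h : ∀ i k, Measurable fun θ : Param (Fin n) => θ.2.1 i k := fun i k =>
    (measurable_pi_apply k).comp ((measurable_pi_apply i).comp
      (measurable_subtype_coe.comp measurable_snd))
  unfold sigmaSq
  exact ((h i i).add (h k k)).sub ((h i k).const_mul 2)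

theorem Setup.Admissible.measurable_stepCost (h : S.Admissible α) {k : ℕ} (hk : k ≤ S.L) :
    Measurable (S.stepCost α k) := by
  have hk' : k - 1 ≤ S.L := (Nat.sub_le k 1).trans hk
  have hs : Measurable (Prod.snd : Param (Fin S.ns) × Path S.ns → Path S.ns) := measurable_snd
  have hq := (h.measurable_q hk).comp hs
  have hq' := (h.measurable_q hk').comp hs
  have hsel : ∀ i, MeasurableSet {ω : Param (Fin S.ns) × Path S.ns | i ∈ α.selected (k - 1) ω.2} :=
    fun i => hs (h.measurableSet_mem_selected hk' i)
  have hμ : ∀ i, Measurable fun ω : Param (Fin S.ns) × Path S.ns => ω.1.1 i := fun i =>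
    (measurable_pi_apply i).comp (measurable_fst.comp measurable_fst)
  have hpos := measurable_position hsel hμ
  have h1 : Measurable fun ω : Param (Fin S.ns) × Path S.ns => (α.N k ω.2 : ℝ) :=
    measurable_from_top.comp ((h.measurable_N hk).comp hs)
  have h2 : Measurable fun ω : Param (Fin S.ns) × Path S.ns => (α.N (k - 1) ω.2 : ℝ) :=
    measurable_from_top.comp ((h.measurable_N hk').comp hs)
  unfold Setup.stepCost
  refine Measurable.mul ?_ ?_
  · exact (measurable_from_top (f := fun z : ℕ => (z : ℝ≥0∞))).comp
      (hq'.sub hq)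
  · refine measurable_finset_sup (fun ik => ?_) fun ik => ?_
    · simp only [Finset.mem_filter, Finset.mem_product]
      exact ((hsel _).inter (hsel _)).inter ((measurableSet_lt (hpos _) measurable_const).inter
        ((measurableSet_le hq (hpos _)).inter (measurableSet_lt (hpos _) hq')))
    · have hr := h.measurable_rho hk ik.1 ik.2
      refine ENNReal.measurable_ofReal.comp (Measurable.mul ?_ (Measurable.ite ?_ ?_ ?_))
      · exact ((hμ _).sub (hμ _)).pow_const _
      · exact measurableSet_le measurable_const hr
      · refine Real.measurable_exp.comp (Measurable.neg (Measurable.div ?_ ?_))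
        · exact (h1.sub h2).mul (hr.pow_const 2)
        · exact (((measurable_sigmaSq _ _).comp measurable_fst).add (hr.const_mul _)).const_mul _
      · exact measurable_const

theorem Setup.Admissible.measurable_finalCost (h : S.Admissible α) :
    Measurable (S.finalCost α) := by
  have hs : Measurable (Prod.snd : Param (Fin S.ns) × Path S.ns → Path S.ns) := measurable_snd
  have hμ : ∀ i, Measurable fun ω : Param (Fin S.ns) × Path S.ns => ω.1.1 i := fun i =>
    (measurable_pi_apply i).comp (measurable_fst.comp measurable_fst)
  unfold Setup.finalCost
  refine ENNReal.measurable_ofReal.comp (Measurable.pow_const (Measurable.abs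
    (Measurable.const_mul ?_ _)) _)
  refine measurable_glue (c := fun ω : Param (Fin S.ns) × Path S.ns => α.selected (S.L - 1) ω.2)
    (F := fun A ω => ∑ i ∈ A, (estimate (α.N S.L ω.2) ω.2 i - ω.1.1 i)) (fun A => ?_) fun A => ?_
  · exact measurableSet_finset_eq
      (fun i => hs (h.measurableSet_mem_selected (Nat.sub_le _ _) i)) A
  · exact Finset.measurable_sum _ fun i _ =>
      (measurable_estimate ((h.measurable_N le_rfl).comp hs) hs i).sub (hμ i)

theorem Setup.Admissible.measurable_costToGo (h : S.Admissible α) (l : ℕ) :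
    Measurable (S.costToGo l α) := by
  unfold Setup.costToGo
  refine h.measurable_finalCost.add (Finset.measurable_sum _ fun k hk => ?_)
  exact h.measurable_stepCost ((Finset.mem_Icc.1 hk).2.trans (Nat.sub_le _ _))

/-- Level `k` is decided with the information of step `k - 1`. For `k = 0` the subtraction
truncates, harmlessly, since the value is then constant. -/
theorem Setup.Admissible.N_eq (h : S.Admissible α) {k : ℕ} (hk : k ≤ S.L) {x y : Path S.ns}
    (hxy : α.SameInfo (k - 1) x y) : α.N k x = α.N k y := by
  cases k with
  | zero => rw [h.N_zero, h.N_zero]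
  | succ k =>
    exact (h.predictable.mono (Nat.le_of_succ_le hk)).eq_of_sameInfo hxy (h.N_predictable k hk)

theorem Setup.Admissible.q_eq (h : S.Admissible α) {k : ℕ} (hk : k ≤ S.L) {x y : Path S.ns}
    (hxy : α.SameInfo (k - 1) x y) : α.q k x = α.q k y := by
  cases k with
  | zero => rw [h.q_zero, h.q_zero]
  | succ k =>
    exact (h.predictable.mono (Nat.le_of_succ_le hk)).eq_of_sameInfo hxy (h.q_predictable k hk)

theorem Setup.Admissible.selected_eq (h : S.Admissible α) {k : ℕ} (hk : k ≤ S.L) {x y : Path S.ns}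
    (hxy : α.SameInfo k x y) : α.selected k x = α.selected k y :=
  ((h.predictable.mono hk).sameInfo hxy).2

theorem Setup.Admissible.estimate_eq (h : S.Admissible α) {k : ℕ} {x y : Path S.ns}
    (hxy : α.SameInfo k x y) {i : Fin S.ns} (hi : i ∈ α.selected k x) :
    estimate (α.N k x) x i = estimate (α.N k x) y i := by
  refine estimate_congr fun j hj => ?_
  cases k with
  | zero => rw [h.N_zero] at hj; simp at hj
  | succ k => exact hxy k k.lt_succ_self i (α.selected_succ_subset k x hi) j hj

/-- The cost of step `k` is known, given `θ`, before that step is run: `rho` uses only the estimates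
of step `k - 1`, and `q`, `N` at level `k` are predictable. -/
theorem Setup.Admissible.stepCost_eq (h : S.Admissible α) {k : ℕ} (hk : k ≤ S.L) {x y : Path S.ns}
    (hxy : α.SameInfo (k - 1) x y) (θ : Param (Fin S.ns)) :
    S.stepCost α k (θ, x) = S.stepCost α k (θ, y) := by
  have hk' : k - 1 ≤ S.L := (Nat.sub_le k 1).trans hk
  have hxy' := hxy.mono (Nat.sub_le (k - 1) 1)
  simp only [Setup.stepCost]
  rw [← h.selected_eq hk' hxy, ← h.q_eq hk hxy, ← h.q_eq hk' hxy', ← h.N_eq hk hxy,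
    ← h.N_eq hk' hxy']
  congr 1
  refine Finset.sup_congr rfl fun ik hik => ?_
  have hik' := Finset.mem_product.1 (Finset.mem_filter.1 hik).1
  have hr : rho α k θ x ik.1 ik.2 = rho α k θ y ik.1 ik.2 := by
    unfold rho
    rw [h.estimate_eq hxy hik'.1, h.estimate_eq hxy hik'.2, h.N_eq hk hxy, h.N_eq hk' hxy']
  rw [hr]

theorem Setup.Admissible.finalCost_eq (h : S.Admissible α) {x y : Path S.ns}
    (hxy : α.SameInfo S.L x y) (θ : Param (Fin S.ns)) :
    S.finalCost α (θ, x) = S.finalCost α (θ, y) := by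
  have hL := S.one_le_L
  simp only [Setup.finalCost]
  rw [← h.selected_eq (Nat.sub_le _ _) (hxy.mono (Nat.sub_le _ _)),
    ← h.N_eq le_rfl (hxy.mono (Nat.sub_le _ _))]
  refine congrArg (fun r : ℝ => ENNReal.ofReal (|1 / (S.nw : ℝ) * r| ^ S.p)) ?_
  refine Finset.sum_congr rfl fun i hi => ?_
  congr 1
  refine estimate_congr fun j hj => hxy (S.L - 1) (by lia) i hi j ?_
  rwa [Nat.sub_add_cancel hL]

theorem Setup.Admissible.costToGo_eq (h : S.Admissible α) (l : ℕ) {x y : Path S.ns}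
    (hxy : α.SameInfo S.L x y) (θ : Param (Fin S.ns)) :
    S.costToGo l α (θ, x) = S.costToGo l α (θ, y) := by
  simp only [Setup.costToGo, h.finalCost_eq hxy θ]
  congr 1
  refine Finset.sum_congr rfl fun k hk => ?_
  have hk' : k ≤ S.L := (Finset.mem_Icc.1 hk).2.trans (Nat.sub_le _ _)
  exact h.stepCost_eq hk' (hxy.mono ((Nat.sub_le _ _).trans hk')) θ

theorem Setup.costToGo_succ (S : Setup) {l : ℕ} (hl : l + 2 ≤ S.L) (α : Control S.ns)
    (ω : Param (Fin S.ns) × Path S.ns) :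
    S.costToGo l α ω = S.costToGo (l + 1) α ω + S.stepCost α (l + 1) ω := by
  have : Finset.Icc (l + 1) (S.L - 1) = insert (l + 1) (Finset.Icc (l + 1 + 1) (S.L - 1)) := by
    ext k; simp only [Finset.mem_Icc, Finset.mem_insert]; lia
  rw [Setup.costToGo, Setup.costToGo, this, Finset.sum_insert (by simp),
    add_comm (S.stepCost α (l + 1) ω), ← add_assoc (S.finalCost α ω)]

theorem costToGo_paste (S : Setup) (l : ℕ) (β : ℕ → Control S.ns) (τ : Path S.ns → ℕ)
    (θ : Param (Fin S.ns)) (x : Path S.ns) :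
    S.costToGo l (paste β τ) (θ, x) = S.costToGo l (β (τ x)) (θ, x) := by
  have h1 : S.finalCost (paste β τ) (θ, x) = S.finalCost (β (τ x)) (θ, x) := by
    simp only [Setup.finalCost, selected_paste]; rfl
  have h2 : ∀ k, S.stepCost (paste β τ) k (θ, x) = S.stepCost (β (τ x)) k (θ, x) := by
    intro k; simp only [Setup.stepCost, selected_paste]; rfl
  simp only [Setup.costToGo, h1, h2]

theorem AgreeUpTo.stepCost_eq {S : Setup} {α α' : Control S.ns} {k : ℕ} (h : AgreeUpTo k α α') :
    S.stepCost α' k = S.stepCost α k := by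
  funext ω
  have hk := Nat.sub_le k 1
  have hr : rho α' k = rho α k := by
    funext θ x i j
    simp only [rho, (h k le_rfl).2, (h _ hk).2]
  simp only [Setup.stepCost, hr, (h k le_rfl).1, (h k le_rfl).2, (h _ hk).1, (h _ hk).2,
    (h.mono hk).selected_eq]

end Costs

/-! ### Splicing paths -/

theorem measurable_splice {X : Type*} [MeasurableSpace X] {n : ℕ} {N : X → ℕ} {x y : X → Path n}
    (hN : Measurable N) (hx : Measurable x) (hy : Measurable y) :
    Measurable fun w => splice (N w) (x w) (y w) := by
  refine measurable_pi_iff.2 fun j => ?_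
  exact Measurable.ite (measurableSet_lt measurable_const hN) ((measurable_pi_apply j).comp hx)
    ((measurable_pi_apply j).comp hy)

theorem splice_splice_left {n : ℕ} (N : ℕ) (x y z : Path n) :
    splice N (splice N x y) z = splice N x z := by
  funext j
  by_cases h : j < N <;> simp [splice, h]

theorem splice_splice_of_le {n : ℕ} {N N' : ℕ} (h : N ≤ N') (x y z : Path n) :
    splice N' (splice N x y) z = splice N x (splice N' y z) := by
  funext j
  by_cases h1 : j < N
  · simp [splice, h1, h1.trans_le h]
  · by_cases h2 : j < N' <;> simp [splice, h1, h2]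

/-- On a cylinder, the coordinates below `N` and the others split the product into two factors, one
for each independent copy. -/
theorem map_splice_infinitePi {n : ℕ} (μ : Measure (Fin n → ℝ)) [IsProbabilityMeasure μ] (N : ℕ) :
    ((Measure.infinitePi fun _ : ℕ => μ).prod (Measure.infinitePi fun _ : ℕ => μ)).map
      (fun p => splice N p.1 p.2) = Measure.infinitePi fun _ : ℕ => μ := by
  refine Measure.eq_infinitePi _ fun s t ht => ?_
  rw [Measure.map_apply (measurable_splice measurable_const measurable_fst measurable_snd)
    (MeasurableSet.pi s.countable_toSet fun i _ => ht i)]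
  have : (fun p : Path n × Path n => splice N p.1 p.2) ⁻¹' (s : Set ℕ).pi t =
      ((s.filter (· < N) : Finset ℕ) : Set ℕ).pi t ×ˢ
        ((s.filter (¬ · < N) : Finset ℕ) : Set ℕ).pi t := by
    ext p
    simp only [Set.mem_preimage, Set.mem_pi, Set.mem_prod, Finset.mem_coe, Finset.mem_filter,
      splice]
    constructor
    · intro h
      exact ⟨fun j hj => by simpa [hj.2] using h j hj.1, fun j hj => by simpa [hj.2] using h j hj.1⟩
    · rintro ⟨h1, h2⟩ j hj
      split_ifs with hc
      · exact h1 j ⟨hj, hc⟩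
      · exact h2 j ⟨hj, hc⟩
  rw [this, Measure.prod_prod, Measure.infinitePi_pi _ fun i _ => ht i,
    Measure.infinitePi_pi _ fun i _ => ht i]
  exact Finset.prod_filter_mul_prod_filter_not s (· < N) fun i => μ (t i)

instance {n : ℕ} (mkt : Market n) : IsMarkovKernel mkt.iid := by
  have := mkt.isMarkov
  exact ⟨fun θ => inferInstanceAs (IsProbabilityMeasure (Measure.infinitePi fun _ => mkt.law θ))⟩

/-- Redrawing the simulations after the `N` first ones does not change their joint law. -/
theorem lintegral_iid_splice {n : ℕ} (mkt : Market n) (θ : Param (Fin n)) (N : ℕ)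
    {F : Path n → ℝ≥0∞} (hF : Measurable F) :
    ∫⁻ y, ∫⁻ z, F (splice N y z) ∂(mkt.iid θ) ∂(mkt.iid θ) = ∫⁻ y, F y ∂(mkt.iid θ) := by
  have := mkt.isMarkov
  have hs : Measurable fun p : Path n × Path n => splice N p.1 p.2 :=
    measurable_splice measurable_const measurable_fst measurable_snd
  have h : mkt.iid θ = Measure.infinitePi fun _ : ℕ => mkt.law θ := rfl
  conv_rhs => rw [h, ← map_splice_infinitePi (mkt.law θ) N, ← h]
  rw [lintegral_map hF hs]
  exact (lintegral_prod _ (hF.comp hs).aemeasurable).symm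

/-! ### Conditional expectations -/

section CondE

variable {S : Setup} {mkt : Market S.ns} {α : Control S.ns}

theorem Setup.Admissible.N_le (h : S.Admissible α) {k k' : ℕ} (hk : k ≤ k') (hk' : k' ≤ S.L)
    (x : Path S.ns) : α.N k x ≤ α.N k' x := by
  induction k', hk using Nat.le_induction with
  | base => exact le_rfl
  | succ j hj ih => exact (ih (Nat.le_of_succ_le hk')).trans (h.N_mono j hk' x)

theorem Setup.Admissible.sameInfo_splice (h : S.Admissible α) {k : ℕ} (hk : k ≤ S.L)
    (x y : Path S.ns) : α.SameInfo k x (splice (α.N k x) x y) := by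
  intro l hl i _ j hj
  rw [splice, if_pos (hj.trans_le (h.N_le hl hk x))]

theorem Setup.Admissible.measure_eq {Y : Type*} [MeasurableSpace Y] (h : S.Admissible α) {k : ℕ}
    (hk : k ≤ S.L) {η : Path S.ns → Measure Y} (hη : Measurable[α.filtration k] η)
    {x y : Path S.ns} (hxy : α.SameInfo k x y) : η x = η y := by
  -- Evaluated set by set, to have values in a space whose singletons are measurable.
  ext B hB
  exact (h.predictable.mono hk).eq_of_sameInfo hxy (f := fun x => η x B)
    ((Measure.measurable_coe hB).comp hη)

theorem Setup.Admissible.condE_splice (h : S.Admissible α) {k : ℕ} (hk : k ≤ S.L)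
    {η : Path S.ns → Measure (Param (Fin S.ns))} (hη : Measurable[α.filtration k] η)
    (Φ : Param (Fin S.ns) × Path S.ns → ℝ≥0∞) (x y : Path S.ns) :
    condE mkt k α η Φ (splice (α.N k x) x y) = condE mkt k α η Φ x := by
  have hs := h.sameInfo_splice hk x y
  unfold condE
  rw [← h.measure_eq hk hη hs, ← h.N_eq hk (hs.mono (Nat.sub_le k 1))]
  simp only [splice_splice_left]

theorem condE_eq_lintegral {n : ℕ} (mkt : Market n) (k : ℕ) (α : Control n)
    (η : Path n → Measure (Param (Fin n))) {Φ : Param (Fin n) × Path n → ℝ≥0∞}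
    {f : Param (Fin n) → ℝ≥0∞} {x : Path n}
    (h : ∀ θ y, Φ (θ, splice (α.N k x) x y) = f θ) :
    condE mkt k α η Φ x = ∫⁻ θ, f θ ∂(η x) := by
  simp [condE, h]

theorem measurable_lintegral_iid {n : ℕ} (mkt : Market n) {N : Path n → ℕ} (hN : Measurable N)
    {Φ : Param (Fin n) × Path n → ℝ≥0∞} (hΦ : Measurable Φ) :
    Measurable fun p : Path n × Param (Fin n) =>
      ∫⁻ y, Φ (p.2, splice (N p.1) p.1 y) ∂(mkt.iid p.2) := by
  have h1 : Measurable fun r : (Path n × Param (Fin n)) × Path n =>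
      Φ (r.1.2, splice (N r.1.1) r.1.1 r.2) :=
    hΦ.comp ((measurable_snd.comp measurable_fst).prodMk
      (measurable_splice (hN.comp (measurable_fst.comp measurable_fst))
        (measurable_fst.comp measurable_fst) measurable_snd))
  exact h1.lintegral_kernel_prod_right' (κ := mkt.iid.comap Prod.snd measurable_snd)

/-- The mass of `η x` is only bounded by one because the Bayesian update is the zero measure where
its normalising integral vanishes. -/
theorem measurable_condE {n : ℕ} (mkt : Market n) {k : ℕ} {α : Control n}
    (hN : Measurable (α.N k)) {η : Path n → Measure (Param (Fin n))} (hη : Measurable η)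
    (hη1 : ∀ x, η x Set.univ ≤ 1) {Φ : Param (Fin n) × Path n → ℝ≥0∞} (hΦ : Measurable Φ) :
    Measurable (condE mkt k α η Φ) := by
  let κ : Kernel (Path n) (Param (Fin n)) := ⟨η, hη⟩
  have : IsFiniteKernel κ := ⟨1, ENNReal.one_lt_top, hη1⟩
  exact (measurable_lintegral_iid mkt hN hΦ).lintegral_kernel_prod_right' (κ := κ)

theorem condE_add {n : ℕ} (mkt : Market n) {k : ℕ} {α : Control n} (hN : Measurable (α.N k))
    (η : Path n → Measure (Param (Fin n))) {Φ Ψ : Param (Fin n) × Path n → ℝ≥0∞}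
    (hΦ : Measurable Φ) (x : Path n) :
    condE mkt k α η (fun ω => Φ ω + Ψ ω) x = condE mkt k α η Φ x + condE mkt k α η Ψ x := by
  have hs : ∀ θ : Param (Fin n), Measurable fun y => (θ, splice (α.N k x) x y) := fun θ =>
    measurable_const.prodMk (measurable_splice measurable_const measurable_const measurable_id)
  refine Eq.trans ?_ (lintegral_add_left ((measurable_lintegral_iid mkt hN hΦ).comp
    (measurable_const.prodMk measurable_id : Measurable fun θ : Param (Fin n) => (x, θ))) _)
  exact lintegral_congr fun θ => lintegral_add_left (hΦ.comp (hs θ)) _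

theorem lintegral_stepLaw {n : ℕ} (mkt : Market n) {l : ℕ} {α : Control n}
    (hN : Measurable (α.N l)) (ν : Kernel (Path n) (Param (Fin n))) [IsMarkovKernel ν]
    (past : Measure (Path n)) [IsProbabilityMeasure past]
    {Φ : Param (Fin n) × Path n → ℝ≥0∞} (hΦ : Measurable Φ) :
    ∫⁻ ω, Φ ω ∂(stepLaw mkt l α ν past) = ∫⁻ x, condE mkt l α ν Φ x ∂past := by
  have hf : Measurable fun w : (Path n × Param (Fin n)) × Path n =>
      (w.1.2, splice (α.N l w.1.1) w.1.1 w.2) :=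
    (measurable_snd.comp measurable_fst).prodMk
      (measurable_splice (hN.comp (measurable_fst.comp measurable_fst))
        (measurable_fst.comp measurable_fst) measurable_snd)
  have hg : Measurable fun w : (Path n × Param (Fin n)) × Path n =>
      Φ (w.1.2, splice (α.N l w.1.1) w.1.1 w.2) := hΦ.comp hf
  rw [stepLaw, lintegral_map hΦ hf, Measure.lintegral_compProd hg]
  exact Measure.lintegral_compProd (measurable_lintegral_iid mkt hN hΦ)

theorem isProbabilityMeasure_stepLaw {n : ℕ} (mkt : Market n) {l : ℕ} {α : Control n}
    (hN : Measurable (α.N l)) (ν : Kernel (Path n) (Param (Fin n))) [IsMarkovKernel ν]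
    (past : Measure (Path n)) [IsProbabilityMeasure past] :
    IsProbabilityMeasure (stepLaw mkt l α ν past) := by
  constructor
  rw [← lintegral_one, lintegral_stepLaw mkt hN ν past measurable_const]
  simp [condE]

/-- `condE` is a conditional expectation under the law that `stepLaw` gives to the simulations. -/
theorem Setup.Admissible.lintegral_condE (h : S.Admissible α) {l : ℕ} (hl : l ≤ S.L)
    (ν : Kernel (Path S.ns) (Param (Fin S.ns))) [IsMarkovKernel ν]
    (hν : Measurable[α.filtration l] ν) (past : Measure (Path S.ns)) [IsProbabilityMeasure past]
    {Φ : Param (Fin S.ns) × Path S.ns → ℝ≥0∞} (hΦ : Measurable Φ) :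
    ∫⁻ x, condE mkt l α ν Φ x ∂(stepLaw mkt l α ν past).snd =
      ∫⁻ ω, Φ ω ∂(stepLaw mkt l α ν past) := by
  have hN := h.measurable_N hl
  have hm : Measurable (condE mkt l α ν Φ) :=
    measurable_condE mkt hN ν.measurable (fun x => prob_le_one) hΦ
  rw [Measure.snd, lintegral_map hm measurable_snd, lintegral_stepLaw mkt hN ν past hΦ]
  refine (lintegral_stepLaw mkt hN ν past (hm.comp measurable_snd)).trans ?_
  refine lintegral_congr fun x => ?_
  rw [condE_eq_lintegral mkt l α ν (f := fun _ => condE mkt l α ν Φ x)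
    fun θ y => h.condE_splice hl hν Φ x y]
  simp

/-- The indicator of a measurable null set that contains the exceptional set has zero integral,
hence zero `condE` almost surely; the nested integrals then vanish one after the other. -/
theorem Setup.Admissible.ae_of_ae_stepLaw (h : S.Admissible α) {l : ℕ} (hl : l ≤ S.L)
    {ν : Kernel (Path S.ns) (Param (Fin S.ns))} [IsMarkovKernel ν]
    (hν : Measurable[α.filtration l] ν) {past : Measure (Path S.ns)} [IsProbabilityMeasure past]
    {p : Param (Fin S.ns) × Path S.ns → Prop} (hp : ∀ᵐ ω ∂(stepLaw mkt l α ν past), p ω) :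
    ∀ᵐ x ∂(stepLaw mkt l α ν past).snd, ∀ᵐ θ ∂(ν x), ∀ᵐ y ∂(mkt.iid θ),
      p (θ, splice (α.N l x) x y) := by
  have hN := h.measurable_N hl
  obtain ⟨E, hpE, hE, hE0⟩ := exists_measurable_superset_of_null hp
  have hΦ : Measurable (E.indicator (1 : Param (Fin S.ns) × Path S.ns → ℝ≥0∞)) :=
    measurable_one.indicator hE
  have h0 := h.lintegral_condE (mkt := mkt) hl ν hν past hΦ
  rw [lintegral_indicator_one hE, hE0, lintegral_eq_zero_iff
    (measurable_condE mkt hN ν.measurable (fun x => prob_le_one) hΦ)] at h0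
  filter_upwards [h0] with x hx
  have h1 := (lintegral_eq_zero_iff ((measurable_lintegral_iid mkt hN hΦ).comp
    (measurable_const.prodMk measurable_id : Measurable fun θ : Param (Fin S.ns) => (x, θ)))).1 hx
  filter_upwards [h1] with θ hθ
  have h2 := (lintegral_eq_zero_iff (hΦ.comp (measurable_const.prodMk (measurable_splice
    measurable_const measurable_const measurable_id) :
      Measurable fun y => (θ, splice (α.N l x) x y)))).1 hθ
  filter_upwards [h2] with y hy
  by_contra hc
  have : (θ, splice (α.N l x) x y) ∈ E := hpE hc
  simp [this] at hy

theorem Setup.Admissible.condE_mono_ae (h : S.Admissible α) {l : ℕ} (hl : l ≤ S.L)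
    {ν : Kernel (Path S.ns) (Param (Fin S.ns))} [IsMarkovKernel ν]
    (hν : Measurable[α.filtration l] ν) {past : Measure (Path S.ns)} [IsProbabilityMeasure past]
    {Φ Ψ : Param (Fin S.ns) × Path S.ns → ℝ≥0∞} (hΦΨ : Φ ≤ᵐ[stepLaw mkt l α ν past] Ψ) :
    condE mkt l α ν Φ ≤ᵐ[(stepLaw mkt l α ν past).snd] condE mkt l α ν Ψ := by
  filter_upwards [h.ae_of_ae_stepLaw hl hν hΦΨ] with x hx
  refine lintegral_mono_ae ?_
  filter_upwards [hx] with θ hθ using lintegral_mono_ae hθ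

end CondE

/-! ### Bayes' formula for a dominated family -/

/-- On the support of `f` the density can be inverted, so `m` restricted to it has a density with
respect to a finite measure. -/
theorem sFinite_restrict_support {Z : Type*} [MeasurableSpace Z] {m : Measure Z} {f : Z → ℝ≥0∞}
    (hf : Measurable f) (hf' : ∀ z, f z ≠ ∞) (h : IsFiniteMeasure (m.withDensity f)) :
    SFinite (m.restrict (Function.support f)) := by
  have hs : MeasurableSet (Function.support f) := measurableSet_support hf
  rw [← withDensity_inv_same (μ := m.restrict (Function.support f)) hf
    (by filter_upwards [ae_restrict_mem hs] with z hz using hz)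
    (Filter.Eventually.of_forall hf'), ← restrict_withDensity hs]
  infer_instance

section Bayes

variable {Z Θ : Type*} [TopologicalSpace Z] [SecondCountableTopology Z] [MeasurableSpace Z]
  [BorelSpace Z]

/-- A measure that dominates a family of finite measures with continuous densities can be replaced
by an s-finite one. -/
theorem exists_sFinite_dominating (m : Measure Z) (g : Z → Θ → ℝ≥0)
    (hg : ∀ θ, Continuous fun z => g z θ) (I : Set Θ)
    (hI : ∀ θ ∈ I, IsFiniteMeasure (m.withDensity fun z => (g z θ : ℝ≥0∞))) :
    ∃ m' : Measure Z, SFinite m' ∧ ∀ θ ∈ I,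
      (m.withDensity fun z => (g z θ : ℝ≥0∞)) = m'.withDensity fun z => (g z θ : ℝ≥0∞) := by
  let f : Θ → Z → ℝ≥0∞ := fun θ z => g z θ
  have hf : ∀ θ, Continuous (f θ) := fun θ => ENNReal.continuous_coe.comp (hg θ)
  have hU : ∀ θ, IsOpen (Function.support (f θ)) := fun θ => (hf θ).isOpen_support
  -- Second countability: countably many of the open supports already cover them all, and `m` is
  -- s-finite on each.
  obtain ⟨T, hTI, hT, hTU⟩ := TopologicalSpace.isOpen_biUnion_countable I
    (fun θ => Function.support (f θ)) fun θ _ => hU θ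
  have hE : MeasurableSet (⋃ θ ∈ T, Function.support (f θ)) :=
    (isOpen_biUnion fun θ _ => hU θ).measurableSet
  refine ⟨m.restrict (⋃ θ ∈ T, Function.support (f θ)), ?_, fun θ hθ => ?_⟩
  · rcases T.eq_empty_or_nonempty with rfl | hne
    · simp only [Set.mem_empty_iff_false, Set.iUnion_of_empty, Set.iUnion_empty,
        Measure.restrict_empty]
      infer_instance
    · obtain ⟨t, rfl⟩ := hT.exists_eq_range hne
      rw [Set.biUnion_range, ← iUnion_disjointed, Measure.restrict_iUnion (disjoint_disjointed _)
        (MeasurableSet.disjointed fun k => (hU (t k)).measurableSet)]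
      have : ∀ k, SFinite (m.restrict (disjointed (fun k => Function.support (f (t k))) k)) := by
        intro k
        have := sFinite_restrict_support (hf (t k)).measurable (fun _ => ENNReal.coe_ne_top)
          (hI (t k) (hTI ⟨k, rfl⟩))
        rw [← Measure.restrict_restrict_of_subset
          (disjointed_subset (fun k => Function.support (f (t k))) k)]
        infer_instance
      infer_instance
  -- Each density with `θ ∈ I` vanishes off the union, so restricting `m` changes nothing.
  · rw [← withDensity_indicator hE]
    congr 1
    refine (Set.indicator_eq_self.2 ?_).symm
    rw [hTU]
    exact Set.subset_biUnion_of_mem (u := fun θ => Function.support (f θ)) hθ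

/-- Fubini turns both sides into integrals in `z` of a `g`-weighted integral in `θ`. The posterior
mean of `J` does not depend on `θ`, so its weight integrates to the normalising constant, which
cancels. As `m` need not be s-finite, Fubini is applied to the measure from
`exists_sFinite_dominating`. -/
theorem lintegral_bayes [MeasurableSpace Θ] (ν : Measure Θ) [IsFiniteMeasure ν] (κ : Θ → Measure Z)
    [∀ θ, IsFiniteMeasure (κ θ)] (m : Measure Z) (g : Z → Θ → ℝ≥0)
    (hg : Measurable (Function.uncurry g)) (hgc : ∀ θ, Continuous fun z => g z θ)
    (hgb : ∃ C, ∀ z θ, g z θ ≤ C)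
    (hκ : ∀ᵐ θ ∂ν, κ θ = m.withDensity fun z => (g z θ : ℝ≥0∞))
    {J : Z → Θ → ℝ≥0∞} (hJ : Measurable (Function.uncurry J)) :
    ∫⁻ θ, ∫⁻ z, (∫⁻ θ', g z θ' ∂ν)⁻¹ * ∫⁻ θ', g z θ' * J z θ' ∂ν ∂(κ θ) ∂ν =
      ∫⁻ θ, ∫⁻ z, J z θ ∂(κ θ) ∂ν := by
  obtain ⟨C, hC⟩ := hgb
  obtain ⟨m', hm', hmm'⟩ := exists_sFinite_dominating m g hgc
    {θ | κ θ = m.withDensity fun z => (g z θ : ℝ≥0∞)}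
    fun θ hθ => by rw [← (hθ : κ θ = _)]; infer_instance
  have hG : Measurable fun p : Z × Θ => (g p.1 p.2 : ℝ≥0∞) := hg.coe_nnreal_ennreal
  have hGJ : Measurable fun p : Z × Θ => (g p.1 p.2 : ℝ≥0∞) * J p.1 p.2 := hG.mul hJ
  have hswap : ∀ F : Z → Θ → ℝ≥0∞, Measurable (Function.uncurry F) →
      ∫⁻ θ, ∫⁻ z, F z θ ∂(κ θ) ∂ν = ∫⁻ z, ∫⁻ θ, g z θ * F z θ ∂ν ∂m' := by
    intro F hF
    rw [lintegral_lintegral_swap (hG.mul hF).aemeasurable]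
    refine lintegral_congr_ae ?_
    filter_upwards [hκ] with θ hθ
    rw [hθ, hmm' θ hθ]
    exact lintegral_withDensity_eq_lintegral_mul _ (hG.comp measurable_prodMk_right)
      (hF.comp measurable_prodMk_right)
  have hD : Measurable fun z => ∫⁻ θ', g z θ' ∂ν := hG.lintegral_prod_right'
  have hI : Measurable fun z => ∫⁻ θ', g z θ' * J z θ' ∂ν := hGJ.lintegral_prod_right'
  rw [hswap J hJ, hswap (fun z _ => (∫⁻ θ', g z θ' ∂ν)⁻¹ * ∫⁻ θ', g z θ' * J z θ' ∂ν)
    ((hD.inv.mul hI).comp measurable_fst)]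
  refine lintegral_congr fun z => ?_
  have hGz : Measurable fun θ => (g z θ : ℝ≥0∞) := hG.comp measurable_prodMk_left
  rw [lintegral_mul_const _ hGz, ← mul_assoc]
  have hfin : ∫⁻ θ', (g z θ' : ℝ≥0∞) ∂ν ≠ ∞ := by
    refine ne_top_of_le_ne_top (b := ∫⁻ _, (C : ℝ≥0∞) ∂ν) ?_
      (lintegral_mono fun θ => ENNReal.coe_le_coe.2 (hC z θ))
    rw [lintegral_const]
    exact ENNReal.mul_ne_top ENNReal.coe_ne_top (measure_ne_top ν _)
  -- Where the normalising constant is zero, `g z` vanishes `ν`-almost everywhere, so the weighted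
  -- integral of `J` is zero too.
  by_cases h0 : ∫⁻ θ', (g z θ' : ℝ≥0∞) ∂ν = 0
  · have h1 : ∫⁻ θ', g z θ' * J z θ' ∂ν = 0 := by
      rw [lintegral_eq_zero_iff hGz] at h0
      refine (lintegral_congr_ae ?_).trans lintegral_zero
      filter_upwards [h0] with θ hθ
      simp only [Pi.zero_apply] at hθ
      rw [hθ, zero_mul]
    rw [h1, mul_zero]
  · rw [ENNReal.mul_inv_cancel h0 hfin, one_mul]

end Bayes

/-! ### The Bayesian update -/

section Update

variable {n : ℕ}

theorem measurable_restrict (A : Finset (Fin n)) :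
    Measurable (Param.restrict A : Param (Fin n) → Param A) := by
  refine Measurable.prodMk ?_ (Measurable.subtype_mk ?_)
  · exact measurable_pi_iff.2 fun i => (measurable_pi_apply _).comp measurable_fst
  · exact measurable_pi_iff.2 fun i => measurable_pi_iff.2 fun k => (measurable_pi_apply _).comp
      ((measurable_pi_apply _).comp (measurable_subtype_coe.comp measurable_snd))

theorem measurable_block (A : Finset (Fin n)) (N N' : ℕ) : Measurable (block A N N') :=
  measurable_pi_iff.2 fun _ => (measurable_pi_apply _).comp (measurable_pi_apply _)

/-- The path that contains the block `z` of simulations, completed by `0`. -/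
def fill (A : Finset (Fin n)) (N N' : ℕ) (z : A × Finset.Ico N N' → ℝ) : Path n := fun j i =>
  if h : i ∈ A ∧ j ∈ Finset.Ico N N' then z (⟨i, h.1⟩, ⟨j, h.2⟩) else 0

theorem measurable_fill (A : Finset (Fin n)) (N N' : ℕ) : Measurable (fill A N N') := by
  refine measurable_pi_iff.2 fun j => measurable_pi_iff.2 fun i => ?_
  unfold fill
  split_ifs with h
  · exact measurable_pi_apply _
  · exact measurable_const

theorem block_splice_fill (A : Finset (Fin n)) (N N' : ℕ) (x : Path n)
    (z : A × Finset.Ico N N' → ℝ) : block A N N' (splice N x (fill A N N' z)) = z := by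
  funext ⟨i, j⟩
  have hj := Finset.mem_Ico.1 j.2
  simp [block, splice, fill, not_lt.2 hj.1]

/-- The law `ν` reweighted by the density of the block of simulations. -/
def reweight (g : DensityMap n) (A : Finset (Fin n)) (N N' : ℕ) (ν : Measure (Param (Fin n)))
    (x : Path n) : Measure (Param (Fin n)) :=
  (∫⁻ θ, (g A N N' (block A N N' x) (θ.restrict A) : ℝ≥0∞) ∂ν)⁻¹ •
    ν.withDensity fun θ => (g A N N' (block A N N' x) (θ.restrict A) : ℝ≥0∞)

theorem update_succ (g : DensityMap n) (l : ℕ) (α : Control n)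
    (ν : Path n → Measure (Param (Fin n))) (x : Path n) :
    update g (l + 1) α ν x =
      reweight g (α.selected l x) (α.N l x) (α.N (l + 1) x) (ν x) x := rfl

theorem DensityMap.Regular.measurable_weight {g : DensityMap n} (hg : g.Regular)
    (A : Finset (Fin n)) (N N' : ℕ) :
    Measurable (Function.uncurry fun (x : Path n) (θ : Param (Fin n)) =>
      (g A N N' (block A N N' x) (θ.restrict A) : ℝ≥0∞)) :=
  ((hg.measurable A N N').comp (((measurable_block A N N').comp measurable_fst).prodMk
    ((measurable_restrict A).comp measurable_snd))).coe_nnreal_ennreal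

theorem reweight_univ_le (g : DensityMap n) (A : Finset (Fin n)) (N N' : ℕ)
    (ν : Measure (Param (Fin n))) (x : Path n) : reweight g A N N' ν x Set.univ ≤ 1 := by
  simp only [reweight, Measure.smul_apply, withDensity_apply _ MeasurableSet.univ,
    Measure.restrict_univ, smul_eq_mul]
  exact ENNReal.inv_mul_le_one _

theorem lintegral_reweight {g : DensityMap n} (hg : g.Regular) (A : Finset (Fin n)) (N N' : ℕ)
    (ν : Measure (Param (Fin n))) (x : Path n) {f : Param (Fin n) → ℝ≥0∞} (hf : Measurable f) :
    ∫⁻ θ, f θ ∂(reweight g A N N' ν x) =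
      (∫⁻ θ, (g A N N' (block A N N' x) (θ.restrict A) : ℝ≥0∞) ∂ν)⁻¹ *
        ∫⁻ θ, (g A N N' (block A N N' x) (θ.restrict A) : ℝ≥0∞) * f θ ∂ν := by
  have hw : Measurable fun θ => (g A N N' (block A N N' x) (Param.restrict A θ) : ℝ≥0∞) :=
    (hg.measurable_weight A N N').comp (measurable_prodMk_left (x := x))
  rw [reweight, lintegral_smul_measure, smul_eq_mul,
    lintegral_withDensity_eq_lintegral_mul _ hw hf]
  rfl

theorem measurable_reweight {g : DensityMap n} (hg : g.Regular) (A : Finset (Fin n)) (N N' : ℕ)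
    (ν : Kernel (Path n) (Param (Fin n))) [IsFiniteKernel ν] :
    Measurable fun x => reweight g A N N' (ν x) x := by
  have hw := hg.measurable_weight A N N'
  refine Measure.measurable_of_measurable_coe _ fun B hB => ?_
  have h1 : Measurable fun x => ((ν x).withDensity fun θ =>
      (g A N N' (block A N N' x) (θ.restrict A) : ℝ≥0∞)) B := by
    have := Kernel.measurable_coe (Kernel.withDensity ν fun x θ =>
      (g A N N' (block A N N' x) (θ.restrict A) : ℝ≥0∞)) hB
    simpa only [Kernel.withDensity_apply ν hw] using this
  exact (hw.lintegral_kernel_prod_right' (κ := ν)).inv.mul h1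

end Update

/-! ### The tower property for the updated law -/

section Tower

variable {S : Setup} {mkt : Market S.ns} {α : Control S.ns}

theorem Setup.Admissible.update_eq (h : S.Admissible α) (g : DensityMap S.ns) {l : ℕ}
    (hl : l + 1 ≤ S.L) {ν : Path S.ns → Measure (Param (Fin S.ns))}
    (hν : Measurable[α.filtration l] ν) {x y : Path S.ns} (hxy : α.SameInfo (l + 1) x y) :
    update g (l + 1) α ν x = update g (l + 1) α ν y := by
  have hl' := Nat.le_of_succ_le hl
  have hxy' := hxy.mono l.le_succ
  have hb : block (α.selected l x) (α.N l x) (α.N (l + 1) x) x =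
      block (α.selected l x) (α.N l x) (α.N (l + 1) x) y := by
    funext ⟨i, j⟩
    exact hxy l l.lt_succ_self i i.2 j (Finset.mem_Ico.1 j.2).2
  rw [update_succ, update_succ, ← h.selected_eq hl' hxy', ← h.N_eq hl hxy',
    ← h.N_eq hl' (hxy'.mono (Nat.sub_le l 1)), ← h.measure_eq hl' hν hxy', reweight, reweight, hb]

theorem Setup.Admissible.measurable_update (h : S.Admissible α) {g : DensityMap S.ns}
    (hg : g.Regular) {l : ℕ} (hl : l + 1 ≤ S.L) (ν : Kernel (Path S.ns) (Param (Fin S.ns)))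
    [IsFiniteKernel ν] (hν : Measurable[α.filtration l] ν) :
    Measurable[α.filtration (l + 1)] (update g (l + 1) α ν) := by
  refine (h.predictable.mono hl).measurable_filtration ?_ fun x y hxy => h.update_eq g hl hν hxy
  have hl' := Nat.le_of_succ_le hl
  refine measurable_glue (c := fun x => (α.selected l x, α.N l x, α.N (l + 1) x))
    (F := fun a x => reweight g a.1 a.2.1 a.2.2 (ν x) x) (fun a => ?_)
    fun a => measurable_reweight hg _ _ _ ν
  have : {x | (α.selected l x, α.N l x, α.N (l + 1) x) = a} = {x | α.selected l x = a.1} ∩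
      ({x | α.N l x = a.2.1} ∩ {x | α.N (l + 1) x = a.2.2}) := by
    ext x
    simp [Prod.ext_iff]
  rw [this]
  exact (measurableSet_finset_eq (h.measurableSet_mem_selected hl') _).inter
    ((h.measurable_N hl' (measurableSet_singleton _)).inter
      (h.measurable_N hl (measurableSet_singleton _)))

theorem Control.selected_subset (α : Control S.ns) {k k' : ℕ} (hk : k ≤ k') (x : Path S.ns) :
    α.selected k' x ⊆ α.selected k x := by
  induction k', hk using Nat.le_induction with
  | base => exact subset_rfl
  | succ j hj ih => exact (α.selected_succ_subset j x).trans ih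

/-- Beyond `N (l + 1)` both paths equal `z`. Below, a scenario observed at a later step was already
observed at step `l + 1`, because the selected sets shrink, so its first `N (l + 1)` simulations
agree. -/
theorem Setup.Admissible.sameInfo_splice_splice (h : S.Admissible α) {l : ℕ} (hl : l + 1 ≤ S.L)
    {x y : Path S.ns} (hxy : α.SameInfo (l + 1) x y) (z : Path S.ns) :
    α.SameInfo S.L (splice (α.N (l + 1) x) x z) (splice (α.N (l + 1) x) y z) := by
  intro k _ i hi j hj
  have hs := h.sameInfo_splice hl x z
  by_cases hjN : j < α.N (l + 1) x
  · simp only [splice, if_pos hjN]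
    rcases Nat.lt_or_ge l k with hlk | hkl
    · refine hxy l l.lt_succ_self i ?_ j hjN
      rw [h.selected_eq (Nat.le_of_succ_le hl) (hs.mono l.le_succ)]
      exact α.selected_subset hlk.le _ hi
    · have hk : k < l + 1 := Nat.lt_succ_of_le hkl
      refine hxy k hk i ?_ j ?_
      · rwa [h.selected_eq (hk.le.trans hl) (hs.mono hk.le)]
      · rwa [h.N_eq (k := k + 1) (Nat.le_trans hk hl) (hs.mono hk.le)]
  · simp only [splice, if_neg hjN]

/-- With the past frozen, step `l + 1` sees `y` only through its block, so the block may replace the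
path. -/
theorem Setup.Admissible.sameInfo_fill (h : S.Admissible α) {l : ℕ} (hl : l + 1 ≤ S.L)
    (x y : Path S.ns) :
    α.SameInfo (l + 1) (splice (α.N l x) x y) (splice (α.N l x) x
      (fill (α.selected l x) (α.N l x) (α.N (l + 1) x)
        (block (α.selected l x) (α.N l x) (α.N (l + 1) x) y))) := by
  intro k hk i hi j hj
  have hl' := Nat.le_of_succ_le hl
  have hs := h.sameInfo_splice hl' x y
  by_cases hjN : j < α.N l x
  · simp only [splice, if_pos hjN]
  · obtain rfl : k = l := by
      by_contra hne
      have hkl : k + 1 ≤ l := by lia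
      refine hjN (hj.trans_le ((h.N_le hkl hl' _).trans_eq ?_))
      exact (h.N_eq hl' (hs.mono (Nat.sub_le l 1))).symm
    rw [← h.selected_eq hl' hs] at hi
    rw [← h.N_eq hl hs] at hj
    have hc : i ∈ α.selected k x ∧ j ∈ Finset.Ico (α.N k x) (α.N (k + 1) x) :=
      ⟨hi, Finset.mem_Ico.2 ⟨not_lt.1 hjN, hj⟩⟩
    simp only [splice, if_neg hjN, fill, dif_pos hc, block]

theorem Setup.Admissible.condE_update_eq (h : S.Admissible α) (g : DensityMap S.ns) {l : ℕ}
    (hl : l + 1 ≤ S.L) {ν : Path S.ns → Measure (Param (Fin S.ns))}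
    (hν : Measurable[α.filtration l] ν) {Φ : Param (Fin S.ns) × Path S.ns → ℝ≥0∞}
    (hΦ : ∀ θ x y, α.SameInfo S.L x y → Φ (θ, x) = Φ (θ, y)) {x y : Path S.ns}
    (hxy : α.SameInfo (l + 1) x y) :
    condE mkt (l + 1) α (update g (l + 1) α ν) Φ x =
      condE mkt (l + 1) α (update g (l + 1) α ν) Φ y := by
  unfold condE
  rw [← h.update_eq g hl hν hxy, ← h.N_eq hl (hxy.mono l.le_succ)]
  exact lintegral_congr fun θ => lintegral_congr fun z =>
    hΦ _ _ _ (h.sameInfo_splice_splice hl hxy z)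

/-- The density `g` of the blocks of simulations is correct at `θ`, for the given block. -/
def HasBlockDensity {n : ℕ} (mkt : Market n) (m : BaseMeasure n) (g : DensityMap n)
    (θ : Param (Fin n)) (A : Finset (Fin n)) (N N' : ℕ) : Prop :=
  (mkt.iid θ).map (block A N N') =
    (m A N N').withDensity fun z => (g A N N' z (θ.restrict A) : ℝ≥0∞)

/-- The tower property: the conditional expectation given the information after step `l` can be
computed by conditioning first on the information after step `l + 1`, under which the law of the
parameter is the Bayesian update. -/
theorem Setup.Admissible.condE_tower (h : S.Admissible α) {l : ℕ} (hl : l + 1 ≤ S.L)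
    {ν : Kernel (Path S.ns) (Param (Fin S.ns))} [IsMarkovKernel ν]
    (hν : Measurable[α.filtration l] ν) {past : Measure (Path S.ns)} [IsProbabilityMeasure past]
    {m : BaseMeasure S.ns} {g : DensityMap S.ns} (hg : g.Regular)
    (hd : ∀ᵐ ω ∂(stepLaw mkt l α ν past), HasBlockDensity mkt m g ω.1 (α.selected l ω.2)
      (α.N l ω.2) (α.N (l + 1) ω.2))
    {Φ : Param (Fin S.ns) × Path S.ns → ℝ≥0∞} (hΦ : Measurable Φ)
    (hΦs : ∀ θ x y, α.SameInfo S.L x y → Φ (θ, x) = Φ (θ, y)) :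
    condE mkt l α ν Φ =ᵐ[(stepLaw mkt l α ν past).snd]
      condE mkt l α ν fun ω => condE mkt (l + 1) α (update g (l + 1) α ν) Φ ω.2 := by
  have hl' := Nat.le_of_succ_le hl
  filter_upwards [h.ae_of_ae_stepLaw hl' hν hd] with x hx
  set A := α.selected l x with hA
  set N := α.N l x with hNx
  set N' := α.N (l + 1) x with hNx'
  have hNN' : N ≤ N' := h.N_le l.le_succ hl x
  -- The block's shape is fixed by the past `x`, so the property does not depend on `y` and one good
  -- `y` suffices.
  have hκ : ∀ᵐ θ ∂(ν x), HasBlockDensity mkt m g θ A N N' := by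
    filter_upwards [hx] with θ hθ
    obtain ⟨y, hy⟩ := hθ.exists
    have hs := h.sameInfo_splice hl' x y
    rwa [← h.selected_eq hl' hs, ← h.N_eq hl hs, ← h.N_eq hl' (hs.mono (Nat.sub_le l 1))] at hy
  let X : (A × Finset.Ico N N' → ℝ) → Path S.ns := fun z => splice N x (fill A N N' z)
  have hX : Measurable X :=
    measurable_splice measurable_const measurable_const (measurable_fill A N N')
  let J : (A × Finset.Ico N N' → ℝ) → Param (Fin S.ns) → ℝ≥0∞ := fun z θ =>
    ∫⁻ y, Φ (θ, splice N' (X z) y) ∂(mkt.iid θ)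
  have hJ : Measurable (Function.uncurry J) :=
    (measurable_lintegral_iid mkt (N := fun _ => N') measurable_const hΦ).comp
      ((hX.comp measurable_fst).prodMk measurable_snd)
  let G : (A × Finset.Ico N N' → ℝ) → Param (Fin S.ns) → ℝ≥0 := fun z θ =>
    g A N N' z (θ.restrict A)
  have hblock := measurable_block A N N'
  have hK : ∀ z, condE mkt (l + 1) α (update g (l + 1) α ν) Φ (X z) =
      (∫⁻ θ, G z θ ∂(ν x))⁻¹ * ∫⁻ θ, G z θ * J z θ ∂(ν x) := by
    intro z
    have hs := h.sameInfo_splice hl' x (fill A N N' z)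
    have hN1 : α.N (l + 1) (X z) = N' := (h.N_eq hl hs).symm
    have hU : update g (l + 1) α ν (X z) = reweight g A N N' (ν x) (X z) := by
      rw [update_succ, ← h.selected_eq hl' hs, hN1, ← h.N_eq hl' (hs.mono (Nat.sub_le l 1)),
        ← h.measure_eq hl' hν hs]
    have := lintegral_reweight hg A N N' (ν x) (X z) (hJ.comp (measurable_prodMk_left (x := z)))
    rw [block_splice_fill] at this
    rw [condE, hU, hN1]
    exact this
  have hKm : Measurable fun z => condE mkt (l + 1) α (update g (l + 1) α ν) Φ (X z) := by
    refine (measurable_condE mkt (h.measurable_N hl) ((h.measurable_update hg hl ν hν).mono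
      (h.filtration_le hl) le_rfl) (fun x => ?_) hΦ).comp hX
    exact reweight_univ_le g _ _ _ _ _
  have hprob : ∀ θ, IsProbabilityMeasure ((mkt.iid θ).map (block A N N')) := fun θ =>
    Measure.isProbabilityMeasure_map hblock.aemeasurable
  have hbayes := lintegral_bayes (ν x) (fun θ => (mkt.iid θ).map (block A N N')) (m A N N') G
    ((hg.measurable A N N').comp (measurable_fst.prodMk
      ((measurable_restrict A).comp measurable_snd)))
    (fun θ => (hg.continuous A N N').continuous (θ.restrict A))
    ((hg.bounded A N N').imp fun C hC z θ => hC z _) hκ hJ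
  calc condE mkt l α ν Φ x
      = ∫⁻ θ, ∫⁻ z, J z θ ∂((mkt.iid θ).map (block A N N')) ∂(ν x) := by
        refine lintegral_congr fun θ => ?_
        have hJθ : Measurable fun z => J z θ := hJ.comp (measurable_prodMk_right (y := θ))
        -- Redrawing the simulations after `N'` separates the block of step `l + 1` from the future,
        -- which is `J`.
        rw [lintegral_map hJθ hblock,
          ← lintegral_iid_splice mkt θ N' (F := fun y => Φ (θ, splice N x y)) (hΦ.comp
            (measurable_const.prodMk
              (measurable_splice measurable_const measurable_const measurable_id)))]
        refine lintegral_congr fun y => lintegral_congr fun z => ?_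
        rw [← splice_splice_of_le hNN']
        have hs := h.sameInfo_splice_splice hl (h.sameInfo_fill hl x y) z
        rw [← h.N_eq hl (h.sameInfo_splice hl' x y)] at hs
        exact hΦs θ _ _ hs
    _ = ∫⁻ θ, ∫⁻ z, condE mkt (l + 1) α (update g (l + 1) α ν) Φ (X z)
          ∂((mkt.iid θ).map (block A N N')) ∂(ν x) := by
        rw [← hbayes]
        simp only [hK]
    _ = condE mkt l α ν (fun ω => condE mkt (l + 1) α (update g (l + 1) α ν) Φ ω.2) x := by
        refine lintegral_congr fun θ => ?_
        rw [lintegral_map hKm hblock]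
        exact lintegral_congr fun y =>
          (h.condE_update_eq g hl hν hΦs (h.sameInfo_fill hl x y)).symm

end Tower

/-! ### Essential infima of families -/

section EssInf

variable {X : Type*} [MeasurableSpace X] {P : Measure X}
  {T : Set (X → ℝ≥0∞)} {V : X → ℝ≥0∞}

theorem isEssInfFamily_essInfFamily (P : Measure X) [IsFiniteMeasure P] (T : Set (X → ℝ≥0∞)) :
    IsEssInfFamily P T (essInfFamily P T) := by
  have h := exists_isEssInfFamily P T
  rw [essInfFamily, dif_pos h]
  exact h.choose_spec

/-- The essential infimum of a family is the infimum of a sequence of its members. -/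
theorem IsEssInfFamily.exists_seq [IsFiniteMeasure P] (hV : IsEssInfFamily P T V) (hT : T.Nonempty)
    (hm : ∀ f ∈ T, Measurable f) :
    ∃ f : ℕ → X → ℝ≥0∞, (∀ k, f k ∈ T) ∧ (fun x => ⨅ k, f k x) =ᵐ[P] V := by
  let H : Set (ℕ → X → ℝ≥0∞) := {s | ∀ k, s k ∈ T}
  let W : (ℕ → X → ℝ≥0∞) → X → ℝ≥0∞ := fun s x => ⨅ k, s k x
  -- The strictly decreasing bounded transform `(1 + ·)⁻¹` keeps the integrals finite even for
  -- infinite costs; the best sequence maximises `I`.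
  let I : (ℕ → X → ℝ≥0∞) → ℝ≥0∞ := fun s => ∫⁻ x, (1 + W s x)⁻¹ ∂P
  have hWm : ∀ s ∈ H, Measurable (W s) := fun s hs => Measurable.iInf fun k => hm _ (hs k)
  have hImono : ∀ s s' : ℕ → X → ℝ≥0∞, (∀ x, W s x ≤ W s' x) → I s' ≤ I s := fun s s' h =>
    lintegral_mono fun x => ENNReal.inv_le_inv.2 (by gcongr; exact h x)
  obtain ⟨f₀, hf₀⟩ := hT
  have hne : (I '' H).Nonempty := ⟨_, fun _ => f₀, fun _ => hf₀, rfl⟩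
  obtain ⟨u, -, hu, huI⟩ := exists_seq_tendsto_sSup hne (OrderTop.bddAbove _)
  choose s hs hI using huI
  -- All members of a maximising family of sequences, merged into one sequence that attains the
  -- supremum.
  let r : ℕ → X → ℝ≥0∞ := fun k => s k.unpair.1 k.unpair.2
  have hr : r ∈ H := fun k => hs _ _
  have hrI : sSup (I '' H) ≤ I r := by
    refine le_of_tendsto' hu fun k => ?_
    rw [← hI k]
    refine hImono _ _ fun x => le_iInf fun j => (iInf_le _ (Nat.pair k j)).trans ?_
    simp [r]
  refine ⟨r, hr, Filter.EventuallyLE.antisymm (hV.greatest _ (hWm r hr) fun f hf => ?_) ?_⟩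
  -- Prepending `f` cannot increase `I` beyond its maximum, so it leaves the infimum unchanged
  -- almost surely.
  · let r' : ℕ → X → ℝ≥0∞ := fun k => Nat.casesOn k f r
    have hr' : r' ∈ H := by
      intro k
      cases k with
      | zero => exact hf
      | succ k => exact hr k
    have hle : ∀ x, W r' x ≤ W r x := fun x => le_iInf fun k => iInf_le (fun k => r' k x) (k + 1)
    have hfin : I r ≠ ∞ := by
      refine ne_top_of_le_ne_top (measure_ne_top P Set.univ) ?_
      calc I r ≤ ∫⁻ _, 1 ∂P := lintegral_mono fun x => by simp
        _ = P Set.univ := by simp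
    have hae : (fun x => (1 + W r x)⁻¹) =ᵐ[P] fun x => (1 + W r' x)⁻¹ := by
      refine ae_eq_of_ae_le_of_lintegral_le ?_ hfin ?_
        ((le_sSup (Set.mem_image_of_mem I hr')).trans hrI)
      · exact Filter.Eventually.of_forall fun x => ENNReal.inv_le_inv.2 (by gcongr; exact hle x)
      · exact ((measurable_const.add (hWm r' hr')).inv).aemeasurable
    filter_upwards [hae] with x hx
    have h1 : 1 + W r x = 1 + W r' x := inv_injective hx
    have h2 : W r x = W r' x := (ENNReal.add_right_inj ENNReal.one_ne_top).1 h1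
    exact h2.le.trans (iInf_le (fun k => r' k x) 0)
  · have : ∀ᵐ x ∂P, ∀ k, V x ≤ r k x := ae_all_iff.2 fun k => hV.le _ (hr k)
    filter_upwards [this] with x hx using le_iInf hx

theorem ae_le_of_forall_le_add {f h : X → ℝ≥0∞} (hfh : ∀ ε : ℝ≥0∞, ε ≠ 0 →
    ∀ᵐ x ∂P, f x ≤ h x + ε) : f ≤ᵐ[P] h := by
  have : ∀ᵐ x ∂P, ∀ k : ℕ, f x ≤ h x + ((k + 1 : ℕ) : ℝ≥0∞)⁻¹ := ae_all_iff.2 fun k =>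
    hfh _ (ENNReal.inv_ne_zero.2 (ENNReal.natCast_ne_top _))
  filter_upwards [this] with x hx
  have ht : Filter.Tendsto (fun k : ℕ => h x + ((k + 1 : ℕ) : ℝ≥0∞)⁻¹) Filter.atTop
      (nhds (h x + 0)) := tendsto_const_nhds.add
    ((Filter.tendsto_add_atTop_iff_nat 1).2 ENNReal.tendsto_inv_nat_nhds_zero)
  rw [add_zero] at ht
  exact ge_of_tendsto' ht hx

end EssInf

/-! ### Dynamic programming -/

section Dynamic

variable {S : Setup} {mkt : Market S.ns} {α : Control S.ns}

/-- The Bayesian update is the conditional law of the parameter after the next step. -/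
theorem Setup.Admissible.isPosterior_update (h : S.Admissible α) {l : ℕ} (hl : l + 1 ≤ S.L)
    {ν : Kernel (Path S.ns) (Param (Fin S.ns))} [IsMarkovKernel ν]
    (hν : Measurable[α.filtration l] ν) {past : Measure (Path S.ns)} [IsProbabilityMeasure past]
    {m : BaseMeasure S.ns} {g : DensityMap S.ns} (hg : g.Regular)
    (hd : ∀ᵐ ω ∂(stepLaw mkt l α ν past), HasBlockDensity mkt m g ω.1 (α.selected l ω.2)
      (α.N l ω.2) (α.N (l + 1) ω.2)) :
    IsPosterior (stepLaw mkt l α ν past) α (l + 1) (update g (l + 1) α ν) := by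
  classical
  have hl' := Nat.le_of_succ_le hl
  refine ⟨h.measurable_update hg hl ν hν, fun B hB G hG => ?_⟩
  have hGm : MeasurableSet G := h.filtration_le hl _ hG
  have hGs : ∀ x y, α.SameInfo (l + 1) x y → (x ∈ G ↔ y ∈ G) := fun x y hxy =>
    ((h.predictable.mono hl).sameInfo hxy).1 G hG
  -- The tower property for this indicator is the defining identity of the posterior.
  let Φ : Param (Fin S.ns) × Path S.ns → ℝ≥0∞ := (B ×ˢ G).indicator 1
  have hΦ : Measurable Φ := measurable_one.indicator (hB.prod hGm)
  have hΦs : ∀ θ x y, α.SameInfo (l + 1) x y → Φ (θ, x) = Φ (θ, y) := by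
    intro θ x y hxy
    simp only [Φ, Set.indicator_apply, Set.mem_prod, hGs x y hxy,
      Pi.one_apply]
  have hU : Measurable (update g (l + 1) α ν) :=
    (h.measurable_update hg hl ν hν).mono (h.filtration_le hl) le_rfl
  have hC : condE mkt (l + 1) α (update g (l + 1) α ν) Φ =
      G.indicator fun x => update g (l + 1) α ν x B := by
    funext x
    rw [condE_eq_lintegral mkt _ α _ (f := fun θ => Φ (θ, x))
      fun θ y => (hΦs θ _ _ (h.sameInfo_splice hl x y)).symm]
    by_cases hx : x ∈ G
    · rw [Set.indicator_of_mem hx, ← lintegral_indicator_one hB]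
      refine lintegral_congr fun θ => ?_
      simp [Φ, Set.indicator_apply, hx]
    · rw [Set.indicator_of_notMem hx]
      simp [Φ, hx]
  have hCm : Measurable (condE mkt (l + 1) α (update g (l + 1) α ν) Φ) :=
    measurable_condE mkt (h.measurable_N hl) hU (fun x => reweight_univ_le g _ _ _ _ _) hΦ
  calc stepLaw mkt l α ν past (B ×ˢ G)
      = ∫⁻ ω, Φ ω ∂(stepLaw mkt l α ν past) := (lintegral_indicator_one (hB.prod hGm)).symm
    _ = ∫⁻ x, condE mkt l α ν Φ x ∂(stepLaw mkt l α ν past).snd :=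
        (h.lintegral_condE hl' ν hν past hΦ).symm
    _ = ∫⁻ x, condE mkt l α ν (fun ω => condE mkt (l + 1) α (update g (l + 1) α ν) Φ ω.2) x
          ∂(stepLaw mkt l α ν past).snd := lintegral_congr_ae (h.condE_tower hl hν hg hd hΦ
            fun θ x y hxy => hΦs θ x y (hxy.mono hl))
    _ = ∫⁻ ω, condE mkt (l + 1) α (update g (l + 1) α ν) Φ ω.2 ∂(stepLaw mkt l α ν past) :=
        h.lintegral_condE hl' ν hν past (hCm.comp measurable_snd)
    _ = ∫⁻ x in G, update g (l + 1) α ν x B ∂(stepLaw mkt l α ν past).snd := by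
        rw [← lintegral_indicator hGm, ← hC, Measure.snd, lintegral_map hCm measurable_snd]

theorem AgreeUpTo.stepLaw_eq {n : ℕ} {α α' : Control n} {l : ℕ} (h : AgreeUpTo l α α')
    (mkt : Market n) (ν : Kernel (Path n) (Param (Fin n))) (past : Measure (Path n)) :
    stepLaw mkt l α' ν past = stepLaw mkt l α ν past := by
  unfold stepLaw
  rw [(h l le_rfl).2]

theorem AgreeUpTo.condE_eq {n : ℕ} {α α' : Control n} {l : ℕ} (h : AgreeUpTo l α α')
    (mkt : Market n) : condE mkt l α' = condE mkt l α := by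
  funext ν Φ x
  unfold condE
  rw [(h l le_rfl).2]

theorem AgreeUpTo.update_eq {n : ℕ} {α α' : Control n} {l : ℕ} (h : AgreeUpTo (l + 1) α α')
    (g : DensityMap n) (ν : Path n → Measure (Param (Fin n))) :
    update g (l + 1) α' ν = update g (l + 1) α ν := by
  funext x
  rw [update_succ, update_succ, (h.mono l.le_succ).selected_eq, (h l l.le_succ).2,
    (h (l + 1) le_rfl).2]

theorem Setup.mem_continuations_of_mem (S : Setup) {α α' α'' : Control S.ns} {l : ℕ}
    (h' : α' ∈ S.continuations l α) (h'' : α'' ∈ S.continuations (l + 1) α') :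
    α'' ∈ S.continuations l α :=
  ⟨h''.1, h'.2.1.trans (h''.2.1.mono l.le_succ), h''.2.2⟩

/-- Up to `ε`, the value after the next step is attained by a single continuation. -/
theorem Setup.Admissible.exists_continuation_le (h : S.Admissible α) {g : DensityMap S.ns}
    (hg : g.Regular) {l : ℕ} (hl : l + 1 ≤ S.L) (hα : α ∈ S.continuations (l + 1) α)
    {ν : Kernel (Path S.ns) (Param (Fin S.ns))} [IsMarkovKernel ν]
    (hν : Measurable[α.filtration l] ν) (P : Measure (Path S.ns)) [IsFiniteMeasure P]
    {ε : ℝ≥0∞} (hε : ε ≠ 0) :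
    ∃ β ∈ S.continuations (l + 1) α, ∀ᵐ x ∂P,
      condE mkt (l + 1) β (update g (l + 1) β ν) (S.costToGo (l + 1) β) x ≤
        S.value mkt P (l + 1) α (update g (l + 1) α ν) x + ε := by
  have hU : Measurable (update g (l + 1) α ν) :=
    (h.measurable_update hg hl ν hν).mono (h.filtration_le hl) le_rfl
  have hU1 : ∀ x, update g (l + 1) α ν x Set.univ ≤ 1 := fun x => reweight_univ_le g _ _ _ _ _
  have hCm : ∀ β ∈ S.continuations (l + 1) α,
      Measurable (condE mkt (l + 1) β (update g (l + 1) α ν) (S.costToGo (l + 1) β)) :=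
    fun β hβ => measurable_condE mkt (hβ.1.measurable_N hl) hU hU1 (hβ.1.measurable_costToGo _)
  obtain ⟨f, hf, hfV⟩ := (isEssInfFamily_essInfFamily P {F | ∃ α' ∈ S.continuations (l + 1) α,
    F = condE mkt (l + 1) α' (update g (l + 1) α ν) (S.costToGo (l + 1) α')}).exists_seq
      ⟨_, α, hα, rfl⟩ (by rintro _ ⟨β, hβ, rfl⟩; exact hCm β hβ)
  choose β hβ hβf using hf
  have hfm : ∀ k, Measurable (f k) := fun k => by rw [hβf k]; exact hCm _ (hβ k)
  have hfs : ∀ k x y, α.SameInfo (l + 1) x y → f k x = f k y := by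
    intro k x y hxy
    have hxy' := ((hβ k).2.1.sameInfo_iff x y).2 hxy
    rw [hβf k, ← (hβ k).2.1.update_eq g ν]
    refine (hβ k).1.condE_update_eq g hl ?_ (fun θ x y => (hβ k).1.costToGo_eq (l + 1) (θ := θ))
      hxy'
    rwa [((hβ k).2.1.mono l.le_succ).filtration_eq]
  have hex : ∀ x, ∃ k, f k x ≤ (⨅ k, f k x) + ε := by
    intro x
    by_cases htop : ⨅ k, f k x = ∞
    · exact ⟨0, by simp [htop]⟩
    · obtain ⟨k, hk⟩ := iInf_lt_iff.1 (ENNReal.lt_add_right htop hε)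
      exact ⟨k, hk.le⟩
  classical
  -- The first `ε`-optimal index: measurable, and determined by the information of step `l + 1`
  -- because every `f k` is.
  let τ : Path S.ns → ℕ := fun x => Nat.find (hex x)
  have hτ : Measurable τ := measurable_find hex fun k =>
    measurableSet_le (hfm k) ((Measurable.iInf hfm).add measurable_const)
  have hτs : ∀ x y, α.SameInfo (l + 1) x y → τ x = τ y := by
    intro x y hxy
    have : ∀ k, f k x = f k y := fun k => hfs k x y hxy
    simp only [τ, this]
  have hpaste := paste_mem_continuations h hβ hτ hτs
  refine ⟨_, hpaste, ?_⟩
  filter_upwards [hfV] with x hx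
  have hxV : S.value mkt P (l + 1) α (update g (l + 1) α ν) x = ⨅ k, f k x := hx.symm
  -- Redrawing the future does not change `τ`, so given the past only the control `β (τ x)` is
  -- followed.
  have hcost : condE mkt (l + 1) (paste β τ) (update g (l + 1) (paste β τ) ν)
      (S.costToGo (l + 1) (paste β τ)) x = f (τ x) x := by
    rw [hpaste.2.1.update_eq g ν, hpaste.2.1.condE_eq mkt, hβf, (hβ (τ x)).2.1.condE_eq mkt]
    refine lintegral_congr fun θ => lintegral_congr fun y => ?_
    rw [costToGo_paste, ← hτs _ _ (h.sameInfo_splice hl x y)]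
  rw [hcost, hxV]
  exact Nat.find_spec (hex x)

end Dynamic

end AdaptiveES

end

open AdaptiveES in
theorem proposition4 (S : Setup) (mkt : Market S.ns)
    (M : Set (Measure (Param (Fin S.ns)))) (hM : ∀ ν ∈ M, IsProbabilityMeasure ν)
    (α : Control S.ns) (hα : S.Admissible α) (l : ℕ) (hl : l + 2 ≤ S.L)
    (ν : Kernel (Path S.ns) (Param (Fin S.ns))) (hν : Measurable[α.filtration l] ν)
    (hνM : ∀ x, ν x ∈ M)
    (past : Measure (Path S.ns)) [IsProbabilityMeasure past]
    (m : BaseMeasure S.ns) (g : DensityMap S.ns)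
    (hA : S.LearningAssumption mkt M m g (stepLaw mkt l α ν past) l α) :
    let P := (stepLaw mkt l α ν past).snd
    (∀ α' ∈ S.continuations l α, ∀ᵐ x ∂P, update g (l + 1) α' ν x ∈ M) ∧
    S.value mkt P l α ν =ᵐ[P]
      essInfFamily P {F | ∃ α' ∈ S.continuations l α,
        F = condE mkt l α ν (fun ω =>
          S.value mkt P (l + 1) α' (update g (l + 1) α' ν) ω.2 + S.stepCost α' (l + 1) ω)} := by
  intro P
  have : IsMarkovKernel ν := ⟨fun x => hM _ (hνM x)⟩
  have hl1 : l + 1 ≤ S.L := by lia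
  have hl0 : l ≤ S.L := by lia
  have hN := hα.measurable_N hl0
  have hg := hA.regular
  have : IsProbabilityMeasure (stepLaw mkt l α ν past) :=
    isProbabilityMeasure_stepLaw mkt hN ν past
  have hPdef : P = (stepLaw mkt l α ν past).map Prod.snd := rfl
  have : IsProbabilityMeasure P := by
    rw [hPdef]; exact Measure.isProbabilityMeasure_map measurable_snd.aemeasurable
  have hd : ∀ α' ∈ S.continuations l α, ∀ᵐ ω ∂(stepLaw mkt l α' ν past),
      HasBlockDensity mkt m g ω.1 (α'.selected l ω.2) (α'.N l ω.2) (α'.N (l + 1) ω.2) := by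
    intro α' hα'
    rw [hα'.2.1.stepLaw_eq]
    exact hA.density α' hα'.1 hα'.2.1 (l + 1) l.lt_succ_self hl1
  have hν' : ∀ α' ∈ S.continuations l α, Measurable[α'.filtration l] ν := by
    intro α' hα'
    rwa [hα'.2.1.filtration_eq]
  have hsplit : ∀ α' ∈ S.continuations l α,
      condE mkt l α' ν (S.costToGo l α') =ᵐ[P] fun x =>
        condE mkt l α ν (fun ω => condE mkt (l + 1) α' (update g (l + 1) α' ν)
          (S.costToGo (l + 1) α') ω.2) x + condE mkt l α ν (S.stepCost α' (l + 1)) x := by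
    intro α' hα'
    have ht := hα'.1.condE_tower hl1 (hν' α' hα') hg (hd α' hα')
      (hα'.1.measurable_costToGo (l + 1)) fun θ x y hxy => hα'.1.costToGo_eq (l + 1) hxy θ
    rw [hα'.2.1.stepLaw_eq, hα'.2.1.condE_eq] at ht
    rw [hα'.2.1.condE_eq]
    filter_upwards [ht] with x hx
    rw [← hx, ← condE_add mkt hN ν (hα'.1.measurable_costToGo (l + 1))]
    simp only [← S.costToGo_succ hl]
  have hpull : ∀ {p : Path S.ns → Prop}, (∀ᵐ x ∂P, p x) →
      ∀ᵐ ω ∂(stepLaw mkt l α ν past), p ω.2 := fun hp =>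
    ae_of_ae_map measurable_snd.aemeasurable hp
  have hVm : ∀ α', Measurable (S.value mkt P (l + 1) α' (update g (l + 1) α' ν)) := fun α' =>
    (isEssInfFamily_essInfFamily P _).measurable
  have hVadd : ∀ α' x, condE mkt l α ν (fun ω =>
      S.value mkt P (l + 1) α' (update g (l + 1) α' ν) ω.2 + S.stepCost α' (l + 1) ω) x =
      condE mkt l α ν (fun ω => S.value mkt P (l + 1) α' (update g (l + 1) α' ν) ω.2) x +
        condE mkt l α ν (S.stepCost α' (l + 1)) x := fun α' x =>
    condE_add mkt hN ν ((hVm α').comp measurable_snd) x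
  set T := {F | ∃ α' ∈ S.continuations l α, F = condE mkt l α ν (fun ω =>
    S.value mkt P (l + 1) α' (update g (l + 1) α' ν) ω.2 + S.stepCost α' (l + 1) ω)}
  refine ⟨fun α' hα' => ?_, Filter.EventuallyLE.antisymm ?_ ?_⟩
  · refine hA.posterior_mem α' hα'.1 hα'.2.1 (l + 1) l.le_succ hl1 _ ?_
    have := hα'.1.isPosterior_update hl1 (hν' α' hα') hg (hd α' hα')
    rwa [hα'.2.1.stepLaw_eq] at this
  -- Upper bound: the cost of an `ε`-optimal continuation `β` of `α'` is compared with the value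
  -- after step `l + 1`.
  · refine (isEssInfFamily_essInfFamily P _).greatest _
      (isEssInfFamily_essInfFamily P _).measurable ?_
    rintro _ ⟨α', hα', rfl⟩
    refine ae_le_of_forall_le_add fun ε hε => ?_
    obtain ⟨β, hβ, hβV⟩ := hα'.1.exists_continuation_le (mkt := mkt) hg hl1
      ⟨hα'.1, AgreeUpTo.refl _ _, hα'.2.2⟩ (hν' α' hα') P hε
    have hβl := S.mem_continuations_of_mem hα' hβ
    have hle : S.value mkt P l α ν ≤ᵐ[P] condE mkt l β ν (S.costToGo l β) :=
      (isEssInfFamily_essInfFamily P _).le _ ⟨β, hβl, rfl⟩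
    filter_upwards [hle, hsplit β hβl,
      hα.condE_mono_ae (mkt := mkt) hl0 hν (past := past) (hpull hβV)] with x h1 h2 h3
    refine h1.trans (h2.le.trans ?_)
    have h4 := condE_add mkt hN ν ((hVm α').comp measurable_snd) (Ψ := fun _ => ε) x
    -- The constant `ε` averages to itself, as `ν x` and the law of the simulations are
    -- probabilities.
    rw [condE_eq_lintegral mkt l α ν (Φ := fun _ => ε) (f := fun _ => ε) fun _ _ => rfl,
      lintegral_const, measure_univ, mul_one] at h4
    replace h3 := h3.trans_eq h4
    rw [hVadd, add_right_comm, hβ.2.1.stepCost_eq]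
    exact add_le_add_left h3 _
  -- Lower bound: `α'` competes in the value after step `l + 1` as its own continuation.
  · refine (isEssInfFamily_essInfFamily P _).greatest _
      (isEssInfFamily_essInfFamily P _).measurable ?_
    rintro _ ⟨α', hα', rfl⟩
    have hV : S.value mkt P (l + 1) α' (update g (l + 1) α' ν) ≤ᵐ[P]
        condE mkt (l + 1) α' (update g (l + 1) α' ν) (S.costToGo (l + 1) α') :=
      (isEssInfFamily_essInfFamily P _).le _
        ⟨α', ⟨hα'.1, AgreeUpTo.refl _ _, hα'.2.2⟩, rfl⟩
    filter_upwards [(isEssInfFamily_essInfFamily P T).le _ ⟨α', hα', rfl⟩, hsplit α' hα',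
      hα.condE_mono_ae (mkt := mkt) hl0 hν (past := past) (hpull hV)] with x h1 h2 h3
    refine h1.trans (le_trans ?_ h2.ge)
    rw [hVadd]
    gcongr
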